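/- **Conventions.** A convex polyhedron of dimension $n$ is a (possibly unbounded) finite intersection of closed half-spaces in $\mathbb R^n$ that lies in no proper affine subspace. A (finite) polyhedral cell complex $S$ is a regular cell complex with finitely many closed cells (faces), each face being an injectively embedded copy of a convex polyhedron, such that the relative interiors of the faces partition $S$ and every face of one of these polyhedra is glued by an isometry to a face of $S$. It carries the length metric $\mu$: $\mu(x,y)$ is the infimum of the lengths of finite concatenations of straight segments, each inside one face, from $x$ to $y$. Let $d=\dim S$. Facets are maximal faces, ridges are faces of dimension $d-1$, and $S_{d-2}$ is the union of the faces of dimension at most $d-2$. For $x\in S$ let $\langle x\rangle$ be the smallest face containing $x$. For small $\varepsilon>0$ the spherical link $N_x(\varepsilon)$ is the set of points $y$ with $\mu(x,y)=\varepsilon$ that are equidistant from all points $z\in\langle x\rangle$ with $\mu(x,z)=\varepsilon$. The complex $S$ is positively curved at $x$ if for all sufficiently small $\varepsilon>0$ the link $N_x(\varepsilon)$ is connected and its diameter, in the length metric induced by $\mu$ on $N_x(\varepsilon)$, is less than $\pi\varepsilon$. A *convex polyhedral complex* is a connected finite polyhedral cell complex whose facets all have dimension $d$ and which is positively curved at every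 point of $S_{d-2}$. It is a *convex polyhedral pseudomanifold* if moreover every facet is bounded and every ridge lies in at most two facets. A path is a shortest path if its length equals the distance $\mu$ between its endpoints. The facet sequence $\mathcal L_\gamma$ of a shortest path $\gamma$ is the list, in order, of the facets whose interiors $\gamma$ traverses (one entry for each maximal subinterval of the parameter interval on which $\gamma$ stays in the interiors of facets). For each facet $F$, regard $F$ as contained in its tangent hyperplane $T_F\cong\mathbb R^d$. If distinct facets $F,F'$ share a ridge $R$, the folding map $T_F\to T_{F'}$ along $R$ is the isometry that identifies the two copies of $R$ and for which the image of $F$ does not meet the interior of $F'$. The sequential unfolding of a shortest path starting in the interior of a facet is obtained by composing the folding maps along the ridges that it crosses. Fix a source point $v$ in the interior of a facet. A point $\nu\in T_F$ is a *source image* for the facet $F$ if some shortest path from $v$ to a point $x\in F$, with $x\notin S_{d-2}$, has as its sequential unfolding into $T_F$ the segment $[\nu,x]$. **Proposition.** 1. Let $S$ be a convex polyhedral complex and $r\ge 0$ a real number. There is a positive integer $N=N(r,S)$ such that every shortest path $\gamma$ of length $r$ in $S$ has a well-defined (finite) facet sequence $\mathcal L_\gamma$, and $\mathcal L_\gamma$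 has size at most $N$. 2. Let $S$ be a convex polyhedral pseudomanifold and $v$ a source point in the interior of a facet of $S$. For every facet $F$ of $S$, the set $\mathrm{src}_F$ of source images for $F$ is finite. -/

import Mathlib

open Set Filter Topology
open scoped ENNReal NNReal

/-- A convex polyhedron of dimension `n`: a finite intersection of closed half-spaces of `ℝⁿ` that
is not contained in a proper affine subspace (equivalently, that has an interior point). -/
def IsConvexPolyhedron {n : ℕ} (P : Set (EuclideanSpace ℝ (Fin n))) : Prop :=
  (∃ (m : ℕ) (a : Fin m → EuclideanSpace ℝ (Fin n)) (b : Fin m → ℝ),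
      P = {x | ∀ i, inner ℝ (a i) x ≤ b i}) ∧
    (interior P).Nonempty

/-- A finite polyhedral cell complex. Its closed cells (faces) are indexed by the finite type
`Face`; the closed cell of index `f` is the injective image, under `chart f`, of a convex polyhedron
`poly f` of dimension `faceDim f` (values of `chart f` outside `poly f` play no role).
The relative interiors of the cells partition the underlying set, and every nonempty face of the
polyhedron `poly f` is itself glued to a cell by an isometry. (For a polyhedron the faces in the
sense of polyhedral geometry are the same as the exposed subsets; the polyhedron itself is one.) -/
structure PolyhedralComplex where
  Carrier : Type*
  Face : Type
  [fintypeFace : Fintype Face]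
  faceDim : Face → ℕ
  poly : (f : Face) → Set (EuclideanSpace ℝ (Fin (faceDim f)))
  chart : (f : Face) → EuclideanSpace ℝ (Fin (faceDim f)) → Carrier
  poly_polyhedron : ∀ f, IsConvexPolyhedron (poly f)
  chart_injOn : ∀ f, InjOn (chart f) (poly f)
  partition : ∀ x : Carrier, ∃! f, x ∈ chart f '' interior (poly f)
  face_of_face : ∀ (f : Face) (Q : Set (EuclideanSpace ℝ (Fin (faceDim f)))),
    IsExposed ℝ (poly f) Q → Q.Nonempty →
      ∃ (g : Face)
        (φ : EuclideanSpace ℝ (Fin (faceDim g)) →ᵃⁱ[ℝ] EuclideanSpace ℝ (Fin (faceDim f))),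
        φ '' poly g = Q ∧ ∀ p ∈ poly g, chart g p = chart f (φ p)

namespace PolyhedralComplex

attribute [instance] PolyhedralComplex.fintypeFace

/-- The Euclidean space in which the polyhedron of the face `f` lives. For a facet `F` this is the
tangent hyperplane of `F`, in which `F` is regarded as contained. -/
abbrev Tangent (S : PolyhedralComplex) (f : S.Face) : Type :=
  EuclideanSpace ℝ (Fin (S.faceDim f))

/-- The closed cell with index `f`. -/
def cell (S : PolyhedralComplex) (f : S.Face) : Set S.Carrier := S.chart f '' S.poly f

/-- The relative interior of the closed cell with index `f`. -/
def openCell (S : PolyhedralComplex) (f : S.Face) : Set S.Carrier :=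
  S.chart f '' interior (S.poly f)

/-! ### The piecewise Euclidean length metric -/

/-- `S.Chain x y ℓ`: the points `x` and `y` are joined by a concatenation of finitely many straight
segments, each contained in one closed cell, of total length `ℓ`. -/
inductive Chain (S : PolyhedralComplex) : S.Carrier → S.Carrier → ℝ≥0 → Prop
  | refl (x : S.Carrier) : Chain S x x 0
  | step (f : S.Face) (p q : S.Tangent f) (hp : p ∈ S.poly f) (hq : q ∈ S.poly f)
      (y : S.Carrier) (l : ℝ≥0) (h : Chain S (S.chart f q) y l) :
      Chain S (S.chart f p) y (nndist p q + l)

theorem Chain.trans {S : PolyhedralComplex} {x y z : S.Carrier} {k l : ℝ≥0}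
    (h : S.Chain x y k) (h2 : S.Chain y z l) : S.Chain x z (k + l) := by
  induction h with
  | refl x => simpa using h2
  | step f p q hp hq y m h ih =>
    rw [add_assoc]
    exact Chain.step f p q hp hq z _ (ih h2)

theorem Chain.symm {S : PolyhedralComplex} {x y : S.Carrier} {k : ℝ≥0}
    (h : S.Chain x y k) : S.Chain y x k := by
  induction h with
  | refl x => exact Chain.refl x
  | step f p q hp hq y m h ih =>
    have h1 : S.Chain (S.chart f q) (S.chart f p) (nndist q p + 0) :=
      Chain.step f q p hq hp _ 0 (Chain.refl _)
    have h3 := ih.trans h1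
    rwa [add_zero, nndist_comm, add_comm] at h3

/-- The distance `μ(x, y)`: the infimum of the lengths of all chains of segments from `x` to `y`
(infinite if there is none). -/
noncomputable def mu (S : PolyhedralComplex) (x y : S.Carrier) : ℝ≥0∞ :=
  ⨅ (l : ℝ≥0) (_ : S.Chain x y l), (l : ℝ≥0∞)

/-- The underlying set with the metric `μ`, and the topology that it induces. -/
noncomputable instance (S : PolyhedralComplex) : PseudoEMetricSpace S.Carrier where
  edist x y := S.mu x y
  edist_self x := by
    refine le_antisymm ?_ bot_le
    exact (iInf₂_le (0 : ℝ≥0) (Chain.refl x)).trans (by simp)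
  edist_comm x y :=
    le_antisymm (le_iInf₂ fun l h => iInf₂_le l h.symm) (le_iInf₂ fun l h => iInf₂_le l h.symm)
  edist_triangle x y z := by
    unfold mu
    simp only [ENNReal.iInf_add, ENNReal.add_iInf]
    refine le_iInf₂ fun k hk => le_iInf₂ fun l hl => ?_
    exact (iInf₂_le (l + k) (hl.trans hk)).trans (by simp)

/-! ### Dimension, facets, ridges, skeleton -/

/-- The dimension of the complex. -/
def dimension (S : PolyhedralComplex) : ℕ := Finset.univ.sup S.faceDim

/-- A facet is a maximal face. -/
def IsFacet (S : PolyhedralComplex) (f : S.Face) : Prop :=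
  ∀ g, S.cell f ⊆ S.cell g → g = f

/-- A ridge is a face of dimension `d - 1`, where `d` is the dimension of the complex. -/
def IsRidge (S : PolyhedralComplex) (f : S.Face) : Prop := S.faceDim f + 1 = S.dimension

/-- The union `S_{d-2}` of all faces of dimension at most `d - 2`. -/
def warped (S : PolyhedralComplex) : Set S.Carrier :=
  ⋃ (f : S.Face) (_ : S.faceDim f + 2 ≤ S.dimension), S.cell f

/-- The union of the interiors of the facets. -/
def facetInteriors (S : PolyhedralComplex) : Set S.Carrier :=
  ⋃ (f : S.Face) (_ : S.IsFacet f), S.openCell f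

/-! ### Spherical links and positive curvature -/

/-- The smallest face containing `x`: the intersection of all the faces that contain `x`. -/
def smallestFace (S : PolyhedralComplex) (x : S.Carrier) : Set S.Carrier :=
  ⋂ (f : S.Face) (_ : x ∈ S.cell f), S.cell f

/-- The spherical link of `x` at radius `ε` (meaningful for small `ε > 0`): the points at distance
`ε` from `x` that are equidistant from all the points of the smallest face of `x` that are at
distance `ε` from `x`. -/
def sphericalLink (S : PolyhedralComplex) (x : S.Carrier) (ε : ℝ) : Set S.Carrier :=
  {y | edist x y = ENNReal.ofReal ε ∧
    ∀ z ∈ S.smallestFace x, ∀ w ∈ S.smallestFace x,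
      edist x z = ENNReal.ofReal ε → edist x w = ENNReal.ofReal ε → edist y z = edist y w}

/-- The length metric induced on a subset `A`: the infimum of the lengths of the paths in `A`. -/
noncomputable def inducedLengthDist {X : Type*} [PseudoEMetricSpace X] (A : Set X) (y z : X) :
    ℝ≥0∞ :=
  ⨅ (η : ℝ → X) (_ : ContinuousOn η (Icc 0 1)) (_ : MapsTo η (Icc 0 1) A)
    (_ : η 0 = y) (_ : η 1 = z), eVariationOn η (Icc 0 1)

/-- `S` is positively curved at `x`: for all sufficiently small `ε`, the spherical link of `x` at
radius `ε` is connected, and its diameter in its length metric is less than `π ε`. -/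
def PositivelyCurvedAt (S : PolyhedralComplex) (x : S.Carrier) : Prop :=
  ∀ᶠ ε in 𝓝[>] (0 : ℝ), IsConnected (S.sphericalLink x ε) ∧
    (⨆ (y ∈ S.sphericalLink x ε) (z ∈ S.sphericalLink x ε),
      inducedLengthDist (S.sphericalLink x ε) y z) < ENNReal.ofReal (Real.pi * ε)

/-- Convex polyhedral complexes: connected, all facets of the same dimension, and positively curved
at every point on a face of codimension at least two. -/
structure IsConvex (S : PolyhedralComplex) : Prop where
  connected : ConnectedSpace S.Carrier
  pure : ∀ F, S.IsFacet F → S.faceDim F = S.dimension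
  positivelyCurved : ∀ x ∈ S.warped, S.PositivelyCurvedAt x

/-- Convex polyhedral pseudomanifolds: convex polyhedral complexes in which every facet is bounded
and every ridge lies in at most two facets. -/
structure IsConvexPseudomanifold (S : PolyhedralComplex) : Prop extends S.IsConvex where
  bounded : ∀ F, S.IsFacet F → Bornology.IsBounded (S.poly F)
  ridge_le_two : ∀ R, S.IsRidge R → {F | S.IsFacet F ∧ S.cell R ⊆ S.cell F}.ncard ≤ 2

/-! ### Shortest paths and their facet sequences -/

/-- `γ`, restricted to `[0, r]`, is a shortest path of length `r` (parametrized by arc length): its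
length equals the distance between its endpoints. -/
structure IsShortestPath (S : PolyhedralComplex) (γ : ℝ → S.Carrier) (r : ℝ) : Prop where
  nonneg : 0 ≤ r
  arclength : HasUnitSpeedOn γ (Icc 0 r)
  length_eq : eVariationOn γ (Icc 0 r) = edist (γ 0) (γ r)

/-- `L` is the facet sequence of `γ : [0, r] → S`, the list in order of the facets whose interiors
`γ` traverses. The list has one entry for each maximal subinterval of `[0, r]` on which `γ` stays
in the interiors of the facets; `τ` selects one parameter in each of these subintervals. -/
def IsFacetSequence (S : PolyhedralComplex) (γ : ℝ → S.Carrier) (r : ℝ) (L : List S.Face) : Prop :=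
  ∃ τ : Fin L.length → ℝ, StrictMono τ ∧
    (∀ i, τ i ∈ Icc 0 r ∧ S.IsFacet (L.get i) ∧ γ (τ i) ∈ S.openCell (L.get i)) ∧
    ∀ t ∈ Icc 0 r, γ t ∈ S.facetInteriors →
      ∃! i, ∀ u ∈ uIcc t (τ i), γ u ∈ S.facetInteriors

/-! ### Sequential unfolding and source images -/

/-- `Φ` is the folding map from the tangent hyperplane of the facet `F` to that of the facet `G`
along their common ridge `R`: it identifies the two copies of `R`, and the image of `F` does not
meet the interior of `G`. -/
structure IsFoldingMap (S : PolyhedralComplex) (F G R : S.Face)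
    (Φ : S.Tangent F ≃ᵃⁱ[ℝ] S.Tangent G) : Prop where
  ne : F ≠ G
  facet_left : S.IsFacet F
  facet_right : S.IsFacet G
  ridge : S.IsRidge R
  subset_left : S.cell R ⊆ S.cell F
  subset_right : S.cell R ⊆ S.cell G
  glue : ∀ p ∈ S.poly F, S.chart F p ∈ S.cell R → Φ p ∈ S.poly G ∧ S.chart G (Φ p) = S.chart F p
  disjoint : Disjoint (Φ '' S.poly F) (interior (S.poly G))

/-- The copy in the tangent hyperplane of `F` of the part of `γ` over `[s, t]`. -/
def piece (S : PolyhedralComplex) (γ : ℝ → S.Carrier) (F : S.Face) (s t : ℝ) : Set (S.Tangent F) :=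
  {p | p ∈ S.poly F ∧ S.chart F p ∈ γ '' Icc s t}

/-- `S.UnfoldsTo γ F s Γ`: the path `γ` over `[0, s]` starts in the interior of a facet, traverses
finitely many facets, reaches at time `s` (if `s ≠ 0`) a ridge that its last facet shares with `F`,
and `Γ` is its sequential unfolding into the tangent hyperplane of `F`. -/
inductive UnfoldsTo (S : PolyhedralComplex) (γ : ℝ → S.Carrier) :
    (F : S.Face) → ℝ → Set (S.Tangent F) → Prop
  | start (F : S.Face) (hF : S.IsFacet F) (p : S.Tangent F) (hp : p ∈ interior (S.poly F))
      (h : S.chart F p = γ 0) : UnfoldsTo S γ F 0 {p}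
  | cross (F G R : S.Face) (s t : ℝ) (Γ : Set (S.Tangent F)) (h : UnfoldsTo S γ F s Γ)
      (hst : s < t) (hγ : ∀ u ∈ Ioo s t, γ u ∈ S.openCell F) (ht : γ t ∈ S.cell R)
      (Φ : S.Tangent F ≃ᵃⁱ[ℝ] S.Tangent G) (hΦ : S.IsFoldingMap F G R Φ) :
      UnfoldsTo S γ G t (Φ '' (Γ ∪ S.piece γ F s t))

/-- The set `src_F` of source images for the facet `F`, with source point `v`: a point `ν` belongs to
it if for some shortest path from `v` to a point `x = chart F q` of `F` not on a face of dimension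
at most `d - 2`, the sequential unfolding of this path into the tangent hyperplane of `F` is the
segment `[ν, q]`. -/
def sourceImages (S : PolyhedralComplex) (v : S.Carrier) (F : S.Face) : Set (S.Tangent F) :=
  {ν | ∃ (γ : ℝ → S.Carrier) (r : ℝ) (q : S.Tangent F) (s : ℝ) (Γ : Set (S.Tangent F)),
    S.IsShortestPath γ r ∧ γ 0 = v ∧ q ∈ S.poly F ∧ S.chart F q = γ r ∧ γ r ∉ S.warped ∧
    S.UnfoldsTo γ F s Γ ∧ s ≤ r ∧ (∀ u ∈ Ioo s r, γ u ∈ S.openCell F) ∧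
    Γ ∪ S.piece γ F s r = segment ℝ ν q}

end PolyhedralComplex

/-- A point that almost satisfies a finite system of linear inequalities is close to a solution. -/
theorem exists_solution_near_almost_solution {E ι : Type*} [NormedAddCommGroup E]
    [InnerProductSpace ℝ E] [FiniteDimensional ℝ E] [Finite ι] (a : ι → E) (b : ι → ℝ) {ε : ℝ}
    (hε : 0 < ε) :
    ∃ δ > 0, ∀ z : E, (∀ i, inner ℝ (a i) z ≤ b i + δ) →
      ∃ y : E, (∀ i, inner ℝ (a i) y ≤ b i) ∧ ‖z - y‖ < ε := by
  classical
  have := Fintype.ofFinite ι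
  by_contra! hcon
  choose z hz hfar using fun n : ℕ => hcon (1 / ((n : ℝ) + 1)) (by positivity)
  let U : Ultrafilter ℕ := hyperfilter ℕ
  have hU : (U : Filter ℕ) ≤ atTop := by
    rw [← Nat.cofinite_eq_atTop]; exact hyperfilter_le_cofinite
  have h0 : Tendsto (fun n : ℕ => 1 / ((n : ℝ) + 1)) U (𝓝 0) :=
    tendsto_one_div_add_atTop_nhds_zero_nat.mono_left hU
  let I : Type _ := {i : ι // ∃ M : ℝ, ∀ᶠ n in U, M ≤ inner ℝ (a i) (z n)}
  have hlim : ∀ i : I, ∃ c : ℝ, Tendsto (fun n => inner ℝ (a i.1) (z n)) U (𝓝 c) ∧ c ≤ b i.1 := by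
    rintro ⟨i, M, hM⟩
    have hmem : ∀ᶠ n in U, inner ℝ (a i) (z n) ∈ Icc M (b i + 1) := by
      filter_upwards [hM] with n hn
      refine ⟨hn, (hz n i).trans ?_⟩
      have : 1 / ((n : ℝ) + 1) ≤ 1 := by
        rw [div_le_one (by positivity)]; linarith [n.cast_nonneg (α := ℝ)]
      linarith
    obtain ⟨c, -, hc⟩ := isCompact_Icc.ultrafilter_le_nhds
      (U.map fun n => inner ℝ (a i) (z n)) (le_principal_iff.2 hmem)
    have hc' : Tendsto (fun n => inner ℝ (a i) (z n)) U (𝓝 c) := hc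
    refine ⟨c, hc', ?_⟩
    have h1 : Tendsto (fun n : ℕ => b i + 1 / ((n : ℝ) + 1)) U (𝓝 (b i + 0)) := h0.const_add _
    have := le_of_tendsto_of_tendsto' hc' h1 (fun n => hz n i)
    simpa using this
  choose c hc hcb using hlim
  let T : E →ₗ[ℝ] (I → ℝ) := LinearMap.pi fun i => (innerₛₗ ℝ (a i.1))
  obtain ⟨s, hs⟩ : ∃ s : (I → ℝ) →ₗ[ℝ] E, ∀ x, T (s (T x)) = T x := by
    obtain ⟨s₀, hs₀⟩ := T.rangeRestrict.exists_rightInverse_of_surjective T.range_rangeRestrict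
    obtain ⟨p, hp⟩ := (LinearMap.range T).subtype.exists_leftInverse_of_injective
      (Submodule.ker_subtype _)
    refine ⟨s₀ ∘ₗ p, fun x => ?_⟩
    have h1 : p (T x) = T.rangeRestrict x := LinearMap.congr_fun hp (T.rangeRestrict x)
    have h2 := congrArg Subtype.val (LinearMap.congr_fun hs₀ (T.rangeRestrict x))
    simpa [h1] using h2
  have hT : Tendsto (fun n => T (z n)) U (𝓝 c) := tendsto_pi_nhds.2 fun i => hc i
  have hsT : Tendsto (fun n => s (T (z n))) U (𝓝 (s c)) :=
    (s.continuous_of_finiteDimensional.tendsto c).comp hT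
  have hTs : ∀ i : I, inner ℝ (a i.1) (s c) = c i := by
    intro i
    have h1 : Tendsto (fun n => inner ℝ (a i.1) (s (T (z n)))) U (𝓝 (inner ℝ (a i.1) (s c))) :=
      tendsto_const_nhds.inner hsT
    refine tendsto_nhds_unique h1 ((hc i).congr fun n => ?_)
    exact (congrFun (hs (z n)) i).symm
  let y : ℕ → E := fun n => z n - s (T (z n)) + s c
  have hy : ∀ᶠ n in U, ∀ i, inner ℝ (a i) (y n) ≤ b i := by
    rw [eventually_all]
    intro i
    by_cases hi : ∃ M : ℝ, ∀ᶠ n in U, M ≤ inner ℝ (a i) (z n)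
    · refine Eventually.of_forall fun n => ?_
      have h1 : inner ℝ (a i) (s (T (z n))) = inner ℝ (a i) (z n) := congrFun (hs (z n)) ⟨i, hi⟩
      simp only [y, inner_add_right, inner_sub_right, h1, hTs ⟨i, hi⟩]
      have := hcb ⟨i, hi⟩
      simpa using this
    · push Not at hi
      have h1 := hi (b i - 1)
      have h2 : Tendsto (fun n => inner ℝ (a i) (s c - s (T (z n)))) U (𝓝 0) := by
        have h4 : Tendsto (fun n => s c - s (T (z n))) U (𝓝 (s c - s c)) := hsT.const_sub _
        have h3 : Tendsto (fun n => inner ℝ (a i) (s c - s (T (z n)))) U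
            (𝓝 (inner ℝ (a i) (s c - s c))) := Filter.Tendsto.inner tendsto_const_nhds h4
        simpa using h3
      filter_upwards [h1, h2.eventually (gt_mem_nhds zero_lt_one)] with n hn hn'
      have : inner ℝ (a i) (y n) = inner ℝ (a i) (z n) + inner ℝ (a i) (s c - s (T (z n))) := by
        simp only [y, inner_add_right, inner_sub_right]; ring
      linarith
  have hclose : ∀ᶠ n in U, ‖z n - y n‖ < ε := by
    have h1 : Tendsto (fun n => z n - y n) U (𝓝 0) := by
      have h2 : Tendsto (fun n => s (T (z n)) - s c) U (𝓝 (s c - s c)) := hsT.sub_const _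
      rw [sub_self] at h2
      exact h2.congr fun n => by simp only [y]; abel
    exact (tendsto_zero_iff_norm_tendsto_zero.1 h1).eventually (gt_mem_nhds hε)
  obtain ⟨n, hn, hn'⟩ := (hy.and hclose).exists
  exact absurd (hfar n (y n) hn) (not_le.2 hn')

namespace PolyhedralComplex
variable (S : PolyhedralComplex)

/-! ### Supporting inequalities of a cell -/

theorem exists_inequalities (f : S.Face) :
    ∃ (m : ℕ) (a : Fin m → S.Tangent f) (b : Fin m → ℝ),
      S.poly f = {x | ∀ i, inner ℝ (a i) x ≤ b i} := (S.poly_polyhedron f).1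

/-- The number of inequalities in a fixed description of the polyhedron of `f`. -/
noncomputable def numIneq (f : S.Face) : ℕ := (S.exists_inequalities f).choose

noncomputable def normal (f : S.Face) : Fin (S.numIneq f) → S.Tangent f :=
  (S.exists_inequalities f).choose_spec.choose

noncomputable def bound (f : S.Face) : Fin (S.numIneq f) → ℝ :=
  (S.exists_inequalities f).choose_spec.choose_spec.choose

variable {S}

theorem mem_poly {f : S.Face} {p : S.Tangent f} :
    p ∈ S.poly f ↔ ∀ i, inner ℝ (S.normal f i) p ≤ S.bound f i := by
  have h := (S.exists_inequalities f).choose_spec.choose_spec.choose_spec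
  rw [Set.ext_iff] at h
  exact h p

/-- The inequalities of the polyhedron of `f` that are equalities at `p`. -/
def active (f : S.Face) (p : S.Tangent f) : Set (Fin (S.numIneq f)) :=
  {i | inner ℝ (S.normal f i) p = S.bound f i}

theorem convex_poly (f : S.Face) : Convex ℝ (S.poly f) := by
  intro p hp q hq s t hs ht hst
  rw [mem_poly] at *
  intro i
  rw [inner_add_right, inner_smul_right, inner_smul_right]
  calc _ ≤ s * S.bound f i + t * S.bound f i := by gcongr <;> simp [hp, hq]
    _ = S.bound f i := by rw [← add_mul, hst, one_mul]

theorem interior_poly_nonempty (f : S.Face) : (interior (S.poly f)).Nonempty :=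
  (S.poly_polyhedron f).2

theorem eventually_add_smul_mem_interior {f : S.Face} {p : S.Tangent f}
    (hp : p ∈ interior (S.poly f)) (v : S.Tangent f) :
    ∀ᶠ s in 𝓝 (0 : ℝ), p + s • v ∈ interior (S.poly f) := by
  have hc : Tendsto (fun s : ℝ => p + s • v) (𝓝 0) (𝓝 (p + (0 : ℝ) • v)) :=
    (continuous_const.add (continuous_id.smul continuous_const)).tendsto 0
  rw [zero_smul, add_zero] at hc
  exact hc.eventually (isOpen_interior.mem_nhds hp)

/-- `φ` glues the polyhedron of `g` into the polyhedron of `f`. -/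
def Glues {g f : S.Face} (φ : S.Tangent g →ᵃⁱ[ℝ] S.Tangent f) : Prop :=
  ∀ z ∈ S.poly g, φ z ∈ S.poly f ∧ S.chart f (φ z) = S.chart g z

theorem affineIsometry_apply {g f : S.Face} (φ : S.Tangent g →ᵃⁱ[ℝ] S.Tangent f)
    (x y : S.Tangent g) : φ y = φ x + φ.linearIsometry (y - x) := by
  have := φ.map_vsub y x
  simp only [vsub_eq_sub] at this
  rw [this]; abel

theorem Glues.inner_normal {g f : S.Face} {φ : S.Tangent g →ᵃⁱ[ℝ] S.Tangent f} (hφ : Glues φ)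
    {y : S.Tangent g} (hy : y ∈ interior (S.poly g)) {i : Fin (S.numIneq f)}
    (hi : i ∈ active f (φ y)) (v : S.Tangent g) :
    inner ℝ (S.normal f i) (φ.linearIsometry v) = 0 := by
  have key : ∀ s : ℝ, y + s • v ∈ S.poly g →
      s * inner ℝ (S.normal f i) (φ.linearIsometry v) ≤ 0 := by
    intro s hs
    have h1 := mem_poly.1 (hφ _ hs).1 i
    rw [affineIsometry_apply φ y, add_sub_cancel_left, map_smul, inner_add_right,
      inner_smul_right] at h1
    have h2 : inner ℝ (S.normal f i) (φ y) = S.bound f i := hi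
    linarith
  have hev := eventually_add_smul_mem_interior hy v
  obtain ⟨s, hs, hs0⟩ := ((hev.filter_mono nhdsWithin_le_nhds).and
      (self_mem_nhdsWithin : Ioi (0 : ℝ) ∈ 𝓝[>] 0)).exists
  obtain ⟨s', hs', hs0'⟩ := ((hev.filter_mono nhdsWithin_le_nhds).and
      (self_mem_nhdsWithin : Iio (0 : ℝ) ∈ 𝓝[<] 0)).exists
  have h1 := key s (interior_subset hs)
  have h2 := key s' (interior_subset hs')
  have hs0 : 0 < s := hs0
  have hs0' : s' < 0 := hs0'
  apply le_antisymm
  · by_contra h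
    exact absurd h1 (not_le.2 (mul_pos hs0 (not_le.1 h)))
  · by_contra h
    exact absurd h2 (not_le.2 (mul_pos_of_neg_of_neg hs0' (not_le.1 h)))

/-- Every point of a polyhedron lies in the relative interior of a glued face, which consists of
the points at which the same inequalities are equalities. -/
theorem exists_glues (f : S.Face) {p : S.Tangent f} (hp : p ∈ S.poly f) :
    ∃ (g : S.Face) (φ : S.Tangent g →ᵃⁱ[ℝ] S.Tangent f) (y : S.Tangent g),
      Glues φ ∧ y ∈ interior (S.poly g) ∧ φ y = p ∧
      ∀ q ∈ S.poly f, active f p ⊆ active f q ↔ q ∈ φ '' S.poly g := by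
  classical
  let A : Finset (Fin (S.numIneq f)) := Finset.univ.filter (· ∈ active f p)
  have hA : ∀ i, i ∈ A ↔ i ∈ active f p := fun i => by simp [A]
  let Q : Set (S.Tangent f) := {q ∈ S.poly f | active f p ⊆ active f q}
  have hpQ : p ∈ Q := ⟨hp, Subset.rfl⟩
  have hexp : IsExposed ℝ (S.poly f) Q := by
    intro _
    refine ⟨innerSL ℝ (∑ i ∈ A, S.normal f i), ?_⟩
    have hl : ∀ x, innerSL ℝ (∑ i ∈ A, S.normal f i) x = ∑ i ∈ A, inner ℝ (S.normal f i) x :=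
      fun x => by rw [innerSL_apply_apply, sum_inner]
    have hle : ∀ x ∈ S.poly f, ∀ i ∈ A, inner ℝ (S.normal f i) x ≤ S.bound f i :=
      fun x hx i _ => mem_poly.1 hx i
    ext x
    constructor
    · rintro ⟨hx, hact⟩
      refine ⟨hx, fun y hy => ?_⟩
      rw [hl, hl]
      refine Finset.sum_le_sum fun i hi => (hle y hy i hi).trans_eq ?_
      exact (hact ((hA i).1 hi)).symm
    · rintro ⟨hx, hmax⟩
      refine ⟨hx, fun i hi => ?_⟩
      have h1 := hmax p hp
      rw [hl, hl] at h1
      have h2 : ∑ i ∈ A, inner ℝ (S.normal f i) p = ∑ i ∈ A, S.bound f i :=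
        Finset.sum_congr rfl fun i hi => (hA i).1 hi
      have h3 := le_antisymm (Finset.sum_le_sum (hle x hx)) (h2 ▸ h1)
      exact (Finset.sum_eq_sum_iff_of_le (hle x hx)).1 h3 i ((hA i).2 hi)
  obtain ⟨g, φ, hφQ, hφ⟩ := S.face_of_face f Q hexp ⟨p, hpQ⟩
  have hgl : Glues φ := fun z hz => by
    have : φ z ∈ Q := hφQ ▸ mem_image_of_mem φ hz
    exact ⟨this.1, (hφ z hz).symm⟩
  obtain ⟨y, hy, hyp⟩ : p ∈ φ '' S.poly g := hφQ ▸ hpQ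
  refine ⟨g, φ, y, hgl, ?_, hyp, fun q hq => ?_⟩
  · obtain ⟨z₀, hz₀⟩ := interior_poly_nonempty g
    have hz₀Q : φ z₀ ∈ Q := hφQ ▸ mem_image_of_mem φ (interior_subset hz₀)
    let W : Set (S.Tangent g) :=
      {z | ∀ i, i ∉ active f p → inner ℝ (S.normal f i) (φ z) < S.bound f i}
    have hWo : IsOpen W := by
      have : W = ⋂ i, {z | i ∉ active f p → inner ℝ (S.normal f i) (φ z) < S.bound f i} := by
        ext; simp [W]
      rw [this]
      refine isOpen_iInter_of_finite fun i => ?_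
      by_cases hi : i ∈ active f p
      · simp [hi]
      · simp only [hi, not_false_eq_true, forall_const]
        exact isOpen_lt (continuous_const.inner φ.continuous) continuous_const
    have hyW : y ∈ W := fun i hi => by
      rw [hyp]
      exact lt_of_le_of_ne (mem_poly.1 hp i) hi
    refine mem_interior.2 ⟨W, fun z hz => ?_, hWo, hyW⟩
    have hact : ∀ i ∈ active f p, inner ℝ (S.normal f i) (φ z) = S.bound f i := by
      intro i hi
      rw [affineIsometry_apply φ z₀ z, inner_add_right, hgl.inner_normal hz₀ (hz₀Q.2 hi), add_zero]
      exact hz₀Q.2 hi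
    have hzQ : φ z ∈ Q := by
      refine ⟨mem_poly.2 fun i => ?_, hact⟩
      by_cases hi : i ∈ active f p
      · exact (hact i hi).le
      · exact (hz i hi).le
    rw [← hφQ] at hzQ
    obtain ⟨z', hz', h⟩ := hzQ
    rwa [← φ.injective h]
  · rw [hφQ]
    exact ⟨fun h => ⟨hq, h⟩, fun h => h.2⟩

/-! ### The open cell of a point and the order on the cells -/

variable (S) in
/-- The face whose open cell contains `x`. -/
noncomputable def cellOf (x : S.Carrier) : S.Face := (S.partition x).choose

theorem mem_openCell_cellOf (x : S.Carrier) : x ∈ S.openCell (S.cellOf x) :=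
  (S.partition x).choose_spec.1

theorem cellOf_eq {x : S.Carrier} {f : S.Face} (h : x ∈ S.openCell f) : S.cellOf x = f :=
  ((S.partition x).choose_spec.2 f h).symm

theorem openCell_subset_cell (f : S.Face) : S.openCell f ⊆ S.cell f :=
  image_mono interior_subset

theorem mem_cell_cellOf (x : S.Carrier) : x ∈ S.cell (S.cellOf x) :=
  openCell_subset_cell _ (mem_openCell_cellOf x)

theorem chart_mem_cell {f : S.Face} {p : S.Tangent f} (hp : p ∈ S.poly f) :
    S.chart f p ∈ S.cell f := mem_image_of_mem _ hp

theorem cellOf_chart {f : S.Face} {p : S.Tangent f} (hp : p ∈ interior (S.poly f)) :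
    S.cellOf (S.chart f p) = f := cellOf_eq (mem_image_of_mem _ hp)

theorem cell_subset_of_mem {x : S.Carrier} {f : S.Face} (h : x ∈ S.cell f) :
    S.cell (S.cellOf x) ⊆ S.cell f := by
  obtain ⟨p, hp, rfl⟩ := h
  obtain ⟨g, φ, y, hφ, hy, rfl, -⟩ := exists_glues f hp
  rw [(hφ y (interior_subset hy)).2, cellOf_chart hy]
  rintro _ ⟨z, hz, rfl⟩
  exact ⟨φ z, hφ z hz⟩

theorem Glues.unique {g f : S.Face} {φ ψ : S.Tangent g →ᵃⁱ[ℝ] S.Tangent f} (hφ : Glues φ)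
    (hψ : Glues ψ) : φ = ψ := by
  have heq : ∀ z ∈ S.poly g, φ z = ψ z := fun z hz =>
    S.chart_injOn f (hφ z hz).1 (hψ z hz).1 ((hφ z hz).2.trans (hψ z hz).2.symm)
  obtain ⟨y, hy⟩ := interior_poly_nonempty g
  have hlin : ∀ v, φ.linearIsometry v = ψ.linearIsometry v := by
    intro v
    obtain ⟨s, hs, hs0⟩ := (((eventually_add_smul_mem_interior hy v).filter_mono
      nhdsWithin_le_nhds).and (self_mem_nhdsWithin : Ioi (0 : ℝ) ∈ 𝓝[>] 0)).exists
    have h1 := heq _ (interior_subset hs)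
    rw [affineIsometry_apply φ y, affineIsometry_apply ψ y, heq y (interior_subset hy),
      add_sub_cancel_left, map_smul, map_smul] at h1
    exact smul_right_injective _ (ne_of_gt hs0) (add_left_cancel h1)
  ext1 z
  rw [affineIsometry_apply φ y, affineIsometry_apply ψ y, heq y (interior_subset hy), hlin]

theorem exists_emb {g f : S.Face} (h : S.cell g ⊆ S.cell f) :
    ∃ φ : S.Tangent g →ᵃⁱ[ℝ] S.Tangent f, Glues φ := by
  obtain ⟨y, hy⟩ := interior_poly_nonempty g
  obtain ⟨p, hp, hpy⟩ := h (chart_mem_cell (interior_subset hy))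
  obtain ⟨g', φ, y', hφ, hy', rfl, -⟩ := exists_glues f hp
  have : g' = g := by
    rw [← cellOf_chart hy', ← (hφ y' (interior_subset hy')).2, hpy, cellOf_chart hy]
  subst this
  exact ⟨φ, hφ⟩

/-- The gluing map of a face `g` of `f`. -/
noncomputable def emb {g f : S.Face} (h : S.cell g ⊆ S.cell f) :
    S.Tangent g →ᵃⁱ[ℝ] S.Tangent f := (exists_emb h).choose

theorem emb_glues {g f : S.Face} (h : S.cell g ⊆ S.cell f) : Glues (emb h) :=
  (exists_emb h).choose_spec

theorem emb_mem {g f : S.Face} (h : S.cell g ⊆ S.cell f) {z : S.Tangent g} (hz : z ∈ S.poly g) :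
    emb h z ∈ S.poly f := (emb_glues h z hz).1

theorem chart_emb {g f : S.Face} (h : S.cell g ⊆ S.cell f) {z : S.Tangent g} (hz : z ∈ S.poly g) :
    S.chart f (emb h z) = S.chart g z := (emb_glues h z hz).2

theorem emb_emb {g k f : S.Face} (h : S.cell g ⊆ S.cell k) (h' : S.cell k ⊆ S.cell f)
    (h'' : S.cell g ⊆ S.cell f) (z : S.Tangent g) : emb h' (emb h z) = emb h'' z := by
  have hgl : Glues ((emb h').comp (emb h)) := fun z hz =>
    ⟨emb_mem h' (emb_mem h hz), (chart_emb h' (emb_mem h hz)).trans (chart_emb h hz)⟩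
  rw [← hgl.unique (emb_glues h'')]
  rfl

theorem emb_self {g : S.Face} (h : S.cell g ⊆ S.cell g) (z : S.Tangent g) : emb h z = z := by
  have hgl : Glues (AffineIsometry.id : S.Tangent g →ᵃⁱ[ℝ] S.Tangent g) := fun z hz => ⟨hz, rfl⟩
  rw [← hgl.unique (emb_glues h)]
  rfl

theorem active_emb {g f : S.Face} (h : S.cell g ⊆ S.cell f) {y : S.Tangent g}
    (hy : y ∈ interior (S.poly g)) {q : S.Tangent f} (hq : q ∈ S.poly f) :
    active f (emb h y) ⊆ active f q ↔ q ∈ emb h '' S.poly g := by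
  obtain ⟨g', φ, y', hφ, hy', hyy, hact⟩ := exists_glues f (emb_mem h (interior_subset hy))
  have : g' = g := by
    rw [← cellOf_chart hy', ← (hφ y' (interior_subset hy')).2, hyy,
      chart_emb h (interior_subset hy), cellOf_chart hy]
  subst this
  rw [hact q hq, hφ.unique (emb_glues h)]

theorem chart_mem_cell_iff {g f : S.Face} (h : S.cell g ⊆ S.cell f) {q : S.Tangent f}
    (hq : q ∈ S.poly f) : S.chart f q ∈ S.cell g ↔ q ∈ emb h '' S.poly g := by
  constructor
  · rintro ⟨z, hz, hzq⟩
    exact ⟨z, hz, S.chart_injOn f (emb_mem h hz) hq ((chart_emb h hz).trans hzq)⟩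
  · rintro ⟨z, hz, rfl⟩
    rw [chart_emb h hz]
    exact chart_mem_cell hz

theorem face_dim_lt {g f : S.Face} (h : S.cell g ⊆ S.cell f) (hne : g ≠ f) :
    S.faceDim g < S.faceDim f := by
  have hle : S.faceDim g ≤ S.faceDim f := by
    simpa using LinearMap.finrank_le_finrank_of_injective (f := (emb h).linearIsometry.toLinearMap)
      (emb h).linearIsometry.injective
  refine lt_of_le_of_ne hle fun heq => hne ?_
  obtain ⟨y, hy⟩ := interior_poly_nonempty g
  have hopen : IsOpenMap (emb h) := by
    have hdim : Module.finrank ℝ (S.Tangent g) = Module.finrank ℝ (S.Tangent f) := by simpa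
    have h1 := ((emb h).linearIsometry.toLinearIsometryEquiv hdim).toHomeomorph.isOpenMap
    have h2 : ⇑(emb h) = fun z =>
        (emb h).linearIsometry.toLinearIsometryEquiv hdim (z - y) + emb h y := by
      ext1 z
      rw [affineIsometry_apply (emb h) y z, add_comm]; rfl
    rw [h2]
    exact ((Homeomorph.addRight (emb h y)).isOpenMap.comp h1).comp
      (Homeomorph.subRight y).isOpenMap
  have himg : emb h y ∈ interior (S.poly f) :=
    interior_maximal (image_subset_iff.2 fun z hz => emb_mem h (interior_subset hz))
      (hopen _ isOpen_interior) (mem_image_of_mem _ hy)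
  rw [← cellOf_chart hy, ← chart_emb h (interior_subset hy), cellOf_chart himg]

theorem cell_injective {g f : S.Face} (h : S.cell g ⊆ S.cell f) (h' : S.cell f ⊆ S.cell g) :
    g = f := by
  by_contra hne
  exact absurd (face_dim_lt h hne) (face_dim_lt h' (Ne.symm hne)).asymm

theorem faceDim_le_dimension (f : S.Face) : S.faceDim f ≤ S.dimension :=
  Finset.le_sup (f := S.faceDim) (Finset.mem_univ f)

variable (S) in
/-- The point of the polyhedron of `f` that represents `x`. -/
noncomputable def pos (f : S.Face) (x : S.Carrier) : S.Tangent f :=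
  Function.invFunOn (S.chart f) (S.poly f) x

theorem pos_mem {f : S.Face} {x : S.Carrier} (h : x ∈ S.cell f) : S.pos f x ∈ S.poly f :=
  Function.invFunOn_mem h

theorem chart_pos {f : S.Face} {x : S.Carrier} (h : x ∈ S.cell f) : S.chart f (S.pos f x) = x :=
  Function.invFunOn_eq h

theorem pos_chart {f : S.Face} {p : S.Tangent f} (hp : p ∈ S.poly f) :
    S.pos f (S.chart f p) = p :=
  S.chart_injOn f (pos_mem (chart_mem_cell hp)) hp (chart_pos (chart_mem_cell hp))

theorem pos_mem_interior {f : S.Face} {x : S.Carrier} (h : x ∈ S.openCell f) :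
    S.pos f x ∈ interior (S.poly f) := by
  obtain ⟨p, hp, rfl⟩ := h
  rwa [pos_chart (interior_subset hp)]

theorem pos_cellOf_mem_interior (x : S.Carrier) :
    S.pos (S.cellOf x) x ∈ interior (S.poly (S.cellOf x)) :=
  pos_mem_interior (mem_openCell_cellOf x)

theorem emb_pos {g f : S.Face} (h : S.cell g ⊆ S.cell f) {x : S.Carrier} (hx : x ∈ S.cell g) :
    emb h (S.pos g x) = S.pos f x := by
  refine S.chart_injOn f (emb_mem h (pos_mem hx)) (pos_mem (h hx)) ?_
  rw [chart_emb h (pos_mem hx), chart_pos hx, chart_pos (h hx)]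

theorem cellOf_eq_of_active {f : S.Face} {p q : S.Tangent f} (hp : p ∈ S.poly f)
    (hq : q ∈ S.poly f) (h : active f p = active f q) :
    S.cellOf (S.chart f p) = S.cellOf (S.chart f q) := by
  have key : ∀ {p q : S.Tangent f}, p ∈ S.poly f → q ∈ S.poly f → active f p ⊆ active f q →
      S.cell (S.cellOf (S.chart f q)) ⊆ S.cell (S.cellOf (S.chart f p)) := by
    intro p q hp hq h
    have hsub := cell_subset_of_mem (chart_mem_cell hp)
    have hpos := emb_pos hsub (mem_cell_cellOf (S.chart f p))
    rw [pos_chart hp] at hpos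
    refine cell_subset_of_mem ((chart_mem_cell_iff hsub hq).2 ?_)
    rw [← active_emb hsub (pos_cellOf_mem_interior _) hq, hpos]
    exact h
  exact cell_injective (key hq hp h.ge) (key hp hq h.le)

theorem isClosed_poly (f : S.Face) : IsClosed (S.poly f) := by
  have : S.poly f = ⋂ i, {p | inner ℝ (S.normal f i) p ≤ S.bound f i} := by
    ext p; simp [mem_poly]
  rw [this]
  exact isClosed_iInter fun i => isClosed_le (continuous_const.inner continuous_id) continuous_const

/-- A point of a face of `f` that is close to another face is close to their intersection. -/
theorem exists_mem_inter_near {ε : ℝ} (hε : 0 < ε) :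
    ∃ δ > 0, ∀ (f g h : S.Face) (hg : S.cell g ⊆ S.cell f), S.cell h ⊆ S.cell f →
      ∀ z ∈ S.poly g, ∀ q ∈ S.poly f, S.chart f q ∈ S.cell h → ‖q - emb hg z‖ < δ →
      ∃ y ∈ S.poly f, S.chart f y ∈ S.cell g ∧ S.chart f y ∈ S.cell h ∧ ‖y - emb hg z‖ < ε := by
  classical
  have main : ∀ f g h : S.Face, ∃ δ > 0, ∀ (hg : S.cell g ⊆ S.cell f), S.cell h ⊆ S.cell f →
      ∀ z ∈ S.poly g, ∀ q ∈ S.poly f, S.chart f q ∈ S.cell h → ‖q - emb hg z‖ < δ →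
      ∃ y ∈ S.poly f, S.chart f y ∈ S.cell g ∧ S.chart f y ∈ S.cell h ∧ ‖y - emb hg z‖ < ε := by
    intro f g h
    by_cases hg : S.cell g ⊆ S.cell f
    swap
    · exact ⟨1, one_pos, fun h => absurd h hg⟩
    by_cases hh : S.cell h ⊆ S.cell f
    swap
    · exact ⟨1, one_pos, fun _ h => absurd h hh⟩
    obtain ⟨yg, hyg⟩ := interior_poly_nonempty g
    obtain ⟨yh, hyh⟩ := interior_poly_nonempty h
    let A := active f (emb hg yg) ∪ active f (emb hh yh)
    let a : Fin (S.numIneq f) ⊕ A → S.Tangent f :=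
      Sum.elim (S.normal f) (fun i => - S.normal f i.1)
    let b : Fin (S.numIneq f) ⊕ A → ℝ := Sum.elim (S.bound f) (fun i => - S.bound f i.1)
    obtain ⟨δ, hδ, H⟩ := exists_solution_near_almost_solution a b hε
    let C : ℝ := ∑ i, ‖S.normal f i‖ + 1
    have hC : 0 < C := by positivity
    have hCi : ∀ i, ‖S.normal f i‖ ≤ C := fun i => by
      have := Finset.single_le_sum (f := fun i => ‖S.normal f i‖) (fun i _ => norm_nonneg _)
        (Finset.mem_univ i)
      simp only [C]; linarith
    refine ⟨δ / C, by positivity, fun _ _ z hz q hq hqh hqz => ?_⟩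
    have hzf := emb_mem hg hz
    have hzact := (active_emb hg hyg hzf).2 (mem_image_of_mem _ hz)
    have hqact := (active_emb hh hyh hq).2 ((chart_mem_cell_iff hh hq).1 hqh)
    obtain ⟨y, hy, hyz⟩ := H (emb hg z) (by
      rintro (i | ⟨i, hi | hi⟩)
      · exact (mem_poly.1 hzf i).trans (by simp only [b, Sum.elim_inl]; linarith)
      · have : inner ℝ (S.normal f i) (emb hg z) = S.bound f i := hzact hi
        simp only [a, b, Sum.elim_inr, inner_neg_left, this]; linarith
      · have h1 : inner ℝ (S.normal f i) q = S.bound f i := hqact hi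
        have h2 : inner ℝ (S.normal f i) (q - emb hg z) ≤ δ := by
          refine (real_inner_le_norm _ _).trans ?_
          calc _ ≤ C * (δ / C) := by gcongr; exact hCi i
            _ = δ := by field_simp
        rw [inner_sub_right, h1] at h2
        simp only [a, b, Sum.elim_inr, inner_neg_left]; linarith)
    have hyf : y ∈ S.poly f := mem_poly.2 fun i => hy (Sum.inl i)
    have hyact : A ⊆ active f y := fun i hi => by
      have h1 := hy (Sum.inr ⟨i, hi⟩)
      simp only [a, b, Sum.elim_inr, inner_neg_left] at h1
      exact le_antisymm (mem_poly.1 hyf i) (by linarith)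
    refine ⟨y, hyf, ?_, ?_, by rwa [norm_sub_rev]⟩
    · exact (chart_mem_cell_iff hg hyf).2
        ((active_emb hg hyg hyf).1 (subset_union_left.trans hyact))
    · exact (chart_mem_cell_iff hh hyf).2
        ((active_emb hh hyh hyf).1 (subset_union_right.trans hyact))
  choose δ hδ H using main
  have hev : ∀ᶠ d in 𝓝[>] (0 : ℝ), ∀ f g h, d < δ f g h := by
    simp only [eventually_all]
    exact fun f g h => (gt_mem_nhds (hδ f g h)).filter_mono nhdsWithin_le_nhds
  obtain ⟨d, hd, hd0⟩ := (hev.and self_mem_nhdsWithin).exists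
  exact ⟨d, hd0, fun f g h hg hh z hz q hq hqh hqz =>
    H f g h hg hh z hz q hq hqh (hqz.trans (hd f g h))⟩

end PolyhedralComplex

/-- A function that is locally constant on an open interval is constant there. -/
theorem eq_of_eventually_eq_on_Ioo {α : Type*} {F : ℝ → α} {a b : ℝ}
    (h : ∀ t ∈ Ioo a b, ∀ᶠ s in 𝓝 t, F s = F t) {s t : ℝ} (hs : s ∈ Ioo a b) (ht : t ∈ Ioo a b) :
    F s = F t := by
  have hloc : IsLocallyConstant (fun x : Ioo a b => F x) := by
    rw [IsLocallyConstant.iff_eventually_eq]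
    intro x
    exact continuous_subtype_val.continuousAt.eventually (h x x.2)
  have : PreconnectedSpace (Ioo a b) := isPreconnected_iff_preconnectedSpace.1 isPreconnected_Ioo
  exact hloc.apply_eq_of_isPreconnected isPreconnected_univ (x := ⟨s, hs⟩) (y := ⟨t, ht⟩)
    trivial trivial

theorem eq_smul_of_norm_sub_eq {E : Type*} [NormedAddCommGroup E] [InnerProductSpace ℝ E]
    {y w : E} (hy : 0 < ‖y‖) (h : ‖w - y‖ = |‖w‖ - ‖y‖|) : w = (‖w‖ / ‖y‖) • y := by
  have h1 : SameRay ℝ w y := sameRay_iff_norm_sub.2 h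
  have h2 := h1.norm_smul_eq
  rw [div_eq_inv_mul, mul_smul, h2, smul_smul, inv_mul_cancel₀ hy.ne', one_smul]

namespace PolyhedralComplex
variable {S : PolyhedralComplex}

/-! ### The metric near a point -/

theorem edist_chart_le {f : S.Face} {p q : S.Tangent f} (hp : p ∈ S.poly f) (hq : q ∈ S.poly f) :
    edist (S.chart f p) (S.chart f q) ≤ ENNReal.ofReal ‖p - q‖ := by
  refine (iInf₂_le (nndist p q + 0) (Chain.step f p q hp hq _ 0 (Chain.refl _))).trans ?_
  rw [add_zero, ← dist_eq_norm, ← edist_dist, edist_nndist]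

theorem edist_le_norm_pos {f : S.Face} {x y : S.Carrier} (hx : x ∈ S.cell f) (hy : y ∈ S.cell f) :
    edist x y ≤ ENNReal.ofReal ‖S.pos f y - S.pos f x‖ := by
  have := edist_chart_le (pos_mem hx) (pos_mem hy)
  rwa [chart_pos hx, chart_pos hy, norm_sub_rev] at this

theorem ofReal_sub_le_edist {F : S.Carrier → ℝ}
    (hF : ∀ f, ∀ p ∈ S.poly f, ∀ q ∈ S.poly f, F (S.chart f q) - F (S.chart f p) ≤ ‖p - q‖)
    (x y : S.Carrier) : ENNReal.ofReal (F y - F x) ≤ edist x y := by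
  have key : ∀ {x y : S.Carrier} {l : ℝ≥0}, S.Chain x y l → F y - F x ≤ l := by
    intro x y l h
    induction h with
    | refl x => simp
    | step f p q hp hq y l h ih =>
      have := hF f p hp q hq
      rw [NNReal.coe_add, coe_nndist, dist_eq_norm]
      linarith
  refine le_iInf₂ fun l hl => ?_
  rw [← ENNReal.ofReal_coe_nnreal]
  exact ENNReal.ofReal_le_ofReal (key hl)

theorem norm_pos_sub_pos {g f : S.Face} (h : S.cell g ⊆ S.cell f) {x y : S.Carrier}
    (hx : x ∈ S.cell g) (hy : y ∈ S.cell g) :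
    ‖S.pos f y - S.pos f x‖ = ‖S.pos g y - S.pos g x‖ := by
  rw [← emb_pos h hx, ← emb_pos h hy, ← dist_eq_norm, ← dist_eq_norm, (emb h).dist_map]

theorem exists_star_radius (x : S.Carrier) :
    ∃ ε > 0, ∀ f, x ∈ S.cell f → ∀ q ∈ S.poly f, ‖q - S.pos f x‖ < ε →
      x ∈ S.cell (S.cellOf (S.chart f q)) := by
  have hev : ∀ᶠ ε in 𝓝[>] (0 : ℝ), ∀ f h : S.Face, x ∈ S.cell f → S.cell h ⊆ S.cell f →
      x ∉ S.cell h → ∀ q ∈ S.poly f, S.chart f q ∈ S.cell h → ε ≤ ‖q - S.pos f x‖ := by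
    simp only [eventually_all]
    intro f h hx hh hxh
    have hcl : IsClosed (emb hh '' S.poly h) :=
      (emb hh).isometry.isClosedEmbedding.isClosedMap _ (isClosed_poly h)
    have hnot : S.pos f x ∉ emb hh '' S.poly h := by
      rw [← chart_mem_cell_iff hh (pos_mem hx), chart_pos hx]
      exact hxh
    obtain ⟨ε, hε, hball⟩ := Metric.isOpen_iff.1 hcl.isOpen_compl _ hnot
    filter_upwards [(gt_mem_nhds hε).filter_mono nhdsWithin_le_nhds] with d hd q hq hqh
    by_contra! hlt
    refine hball (a := q) ?_ ((chart_mem_cell_iff hh hq).1 hqh)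
    rw [Metric.mem_ball, dist_eq_norm]
    exact hlt.trans hd
  obtain ⟨ε, hε, hε0⟩ := (hev.and self_mem_nhdsWithin).exists
  refine ⟨ε, hε0, fun f hx q hq hlt => ?_⟩
  by_contra hnot
  exact absurd hlt (not_lt.2
    (hε f _ hx (cell_subset_of_mem (chart_mem_cell hq)) hnot q hq (mem_cell_cellOf _)))

/-- Near `x` the distance from `x` is the Euclidean distance in any cell. -/
theorem exists_local_radius (x : S.Carrier) :
    ∃ ε > 0, ∀ y, edist x y < ENNReal.ofReal ε → x ∈ S.cell (S.cellOf y) ∧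
      ∀ f, x ∈ S.cell f → y ∈ S.cell f →
        edist x y = ENNReal.ofReal ‖S.pos f y - S.pos f x‖ := by
  classical
  obtain ⟨ε, hε, hstar⟩ := exists_star_radius x
  let F : S.Carrier → ℝ := fun y =>
    if x ∈ S.cell (S.cellOf y) then min ε ‖S.pos (S.cellOf y) y - S.pos (S.cellOf y) x‖ else ε
  have hFle : ∀ y, F y ≤ ε := fun y => by
    simp only [F]
    split_ifs
    exacts [min_le_left _ _, le_rfl]
  have hF1 : ∀ f, x ∈ S.cell f → ∀ p ∈ S.poly f, F (S.chart f p) = min ε ‖p - S.pos f x‖ := by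
    intro f hx p hp
    by_cases h : x ∈ S.cell (S.cellOf (S.chart f p))
    · simp only [F, if_pos h]
      rw [← norm_pos_sub_pos (cell_subset_of_mem (chart_mem_cell hp)) h (mem_cell_cellOf _),
        pos_chart hp]
    · simp only [F, if_neg h]
      refine (min_eq_left ?_).symm
      by_contra! hlt
      exact h (hstar f hx p hp hlt)
  have hlip : ∀ f, ∀ p ∈ S.poly f, ∀ q ∈ S.poly f,
      F (S.chart f q) - F (S.chart f p) ≤ ‖p - q‖ := by
    intro f p hp q hq
    by_cases hx : x ∈ S.cell f
    · rw [hF1 f hx p hp, hF1 f hx q hq]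
      have h1 : ‖q - S.pos f x‖ ≤ ‖p - S.pos f x‖ + ‖p - q‖ := by
        have := norm_sub_le (p - S.pos f x) (p - q)
        rwa [show p - S.pos f x - (p - q) = q - S.pos f x by abel] at this
      rcases min_cases ε ‖p - S.pos f x‖ with h | h <;>
        rcases min_cases ε ‖q - S.pos f x‖ with h' | h' <;>
        linarith [norm_nonneg (p - q)]
    · have h1 : F (S.chart f p) = ε := if_neg fun h =>
        hx (cell_subset_of_mem (chart_mem_cell hp) h)
      have := hFle (S.chart f q)
      linarith [norm_nonneg (p - q)]
  have hx0 : F x = 0 := by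
    have h := hF1 _ (mem_cell_cellOf x) _ (pos_mem (mem_cell_cellOf x))
    rw [chart_pos (mem_cell_cellOf x), sub_self, norm_zero, min_eq_right hε.le] at h
    exact h
  refine ⟨ε, hε, fun y hy => ?_⟩
  have h1 := ofReal_sub_le_edist hlip x y
  rw [hx0, sub_zero] at h1
  have hlt : F y < ε := (ENNReal.ofReal_lt_ofReal_iff hε).1 (h1.trans_lt hy)
  have hmem : x ∈ S.cell (S.cellOf y) := by
    by_contra h
    simp only [F, if_neg h] at hlt
    exact lt_irrefl _ hlt
  refine ⟨hmem, fun f hx hyf => le_antisymm (edist_le_norm_pos hx hyf) ?_⟩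
  have h2 := hF1 f hx _ (pos_mem hyf)
  rw [chart_pos hyf] at h2
  rw [h2] at hlt h1
  rcases min_lt_iff.1 hlt with h | h
  · exact absurd h (lt_irrefl _)
  · rwa [min_eq_right h.le] at h1

/-! ### Initial directions of shortest paths -/

/-- The path `η` issuing from `x` runs initially straight into the interior of the cell of `f`, in
the direction `e`. -/
structure IsRay (x : S.Carrier) (η : ℝ → S.Carrier) (f : S.Face) (e : S.Tangent f) : Prop where
  mem : x ∈ S.cell f
  norm_eq : ‖e‖ = 1
  eventually : ∀ᶠ u in 𝓝[>] (0 : ℝ),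
    S.pos f x + u • e ∈ interior (S.poly f) ∧ S.chart f (S.pos f x + u • e) = η u

theorem cellOf_eq_and_smul_eq {x y z : S.Carrier} {u w : ℝ} (hu : 0 < u) (hw : 0 < w)
    (hx : x ∈ S.cell (S.cellOf y)) (hyz : S.cell (S.cellOf y) ⊆ S.cell (S.cellOf z))
    (hxy : ‖S.pos (S.cellOf z) y - S.pos (S.cellOf z) x‖ = u)
    (hxz : ‖S.pos (S.cellOf z) z - S.pos (S.cellOf z) x‖ = w)
    (hd : ‖S.pos (S.cellOf z) z - S.pos (S.cellOf z) y‖ = |w - u|) :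
    S.cellOf z = S.cellOf y ∧ S.pos (S.cellOf z) z - S.pos (S.cellOf z) x =
      (w / u) • (S.pos (S.cellOf z) y - S.pos (S.cellOf z) x) := by
  set f := S.cellOf z with hf
  set h := S.cellOf y with hh
  have hdir : S.pos f z - S.pos f x = (w / u) • (S.pos f y - S.pos f x) := by
    have := eq_smul_of_norm_sub_eq (y := S.pos f y - S.pos f x) (w := S.pos f z - S.pos f x)
      (by rw [hxy]; exact hu) (by rw [sub_sub_sub_cancel_right, hd, hxy, hxz])
    rwa [hxy, hxz] at this
  refine ⟨?_, hdir⟩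
  have hyh : y ∈ S.cell h := mem_cell_cellOf y
  rcases lt_or_ge u w with huw | hwu
  · have h1 : S.pos f y = (u / w) • S.pos f z + (1 - u / w) • S.pos f x := by
      have : S.pos f y - S.pos f x = (u / w) • (S.pos f z - S.pos f x) := by
        rw [hdir, smul_smul, div_mul_div_cancel₀ hw.ne', div_self hu.ne', one_smul]
      rw [sub_eq_iff_eq_add] at this
      rw [this]; module
    have h2 : S.pos f y ∈ interior (S.poly f) := by
      rw [h1]
      refine (convex_poly f).combo_interior_self_mem_interior (pos_cellOf_mem_interior z)
        (pos_mem (hyz hx)) (by positivity) ?_ (by ring)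
      rw [sub_nonneg, div_le_one hw]
      exact huw.le
    have h3 := cellOf_chart h2
    rw [chart_pos (hyz hyh)] at h3
    exact h3.symm
  · refine cell_injective (cell_subset_of_mem ?_) hyz
    have hmem : S.pos h x + (w / u) • (S.pos h y - S.pos h x) ∈ S.poly h := by
      refine (convex_poly h).add_smul_sub_mem (pos_mem hx) (pos_mem hyh) ⟨by positivity, ?_⟩
      rw [div_le_one hu]
      exact hwu
    have himg : emb hyz (S.pos h x + (w / u) • (S.pos h y - S.pos h x)) = S.pos f z := by
      rw [affineIsometry_apply _ (S.pos h x), add_sub_cancel_left, map_smul]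
      have : (emb hyz).linearIsometry (S.pos h y - S.pos h x) = S.pos f y - S.pos f x := by
        rw [← emb_pos hyz hx, ← emb_pos hyz hyh, affineIsometry_apply _ (S.pos h x) (S.pos h y)]
        abel
      rw [this, ← hdir, emb_pos hyz hx]
      abel
    have := chart_emb hyz hmem
    rw [himg, chart_pos (mem_cell_cellOf z)] at this
    rw [this]
    exact chart_mem_cell hmem

/-- A path along which the metric is the parameter distance starts with a straight segment. -/
theorem exists_isRay {η : ℝ → S.Carrier} {b : ℝ} (hb : 0 < b)
    (hη : ∀ u ∈ Icc 0 b, ∀ w ∈ Icc 0 b, edist (η u) (η w) = ENNReal.ofReal |u - w|) :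
    ∃ f e, IsRay (η 0) η f e := by
  obtain ⟨ε, hε, hloc⟩ := exists_local_radius (η 0)
  set x := η 0 with hx
  let b' := min b ε
  have hb' : 0 < b' := lt_min hb hε
  have hIcc : ∀ u ∈ Ioo 0 b', u ∈ Icc 0 b := fun u hu =>
    ⟨hu.1.le, hu.2.le.trans (min_le_left _ _)⟩
  have hx0 : ∀ u ∈ Ioo 0 b', x ∈ S.cell (S.cellOf (η u)) ∧
      ∀ f, x ∈ S.cell f → η u ∈ S.cell f → ‖S.pos f (η u) - S.pos f x‖ = u := by
    intro u hu
    have h1 : edist x (η u) = ENNReal.ofReal u := by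
      rw [hx, hη 0 ⟨le_rfl, hb.le⟩ u (hIcc u hu), zero_sub, abs_neg, abs_of_pos hu.1]
    obtain ⟨h2, h3⟩ := hloc (η u) (by
      rw [h1, ENNReal.ofReal_lt_ofReal_iff hε]; exact hu.2.trans_le (min_le_right _ _))
    refine ⟨h2, fun f hxf hf => ?_⟩
    have h4 := h3 f hxf hf
    rw [h1, ENNReal.ofReal_eq_ofReal_iff hu.1.le (norm_nonneg _)] at h4
    exact h4.symm
  let G : S.Face → ℝ → (f : S.Face) × S.Tangent f :=
    fun f u => ⟨f, u⁻¹ • (S.pos f (η u) - S.pos f x)⟩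
  let F : ℝ → (f : S.Face) × S.Tangent f := fun u => G (S.cellOf (η u)) u
  have hF : ∀ u ∈ Ioo 0 b', ∀ᶠ w in 𝓝 u, F w = F u := by
    intro u hu
    obtain ⟨ε', hε', hloc'⟩ := exists_local_radius (η u)
    filter_upwards [Ioo_mem_nhds hu.1 hu.2, Metric.ball_mem_nhds u hε'] with w hw hwu
    rw [Metric.mem_ball, Real.dist_eq] at hwu
    have h1 : edist (η u) (η w) = ENNReal.ofReal |w - u| := by
      rw [hη u (hIcc u hu) w (hIcc w hw), abs_sub_comm]
    obtain ⟨h2, h3⟩ := hloc' (η w) (by rwa [h1, ENNReal.ofReal_lt_ofReal_iff hε'])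
    have h4 := h3 (S.cellOf (η w)) h2 (mem_cell_cellOf _)
    rw [h1, ENNReal.ofReal_eq_ofReal_iff (abs_nonneg _) (norm_nonneg _)] at h4
    have hxu := (hx0 u hu).1
    have hsub := cell_subset_of_mem h2
    obtain ⟨hc, hdir⟩ := cellOf_eq_and_smul_eq hu.1 hw.1 hxu hsub
      ((hx0 u hu).2 _ (hsub hxu) h2)
      ((hx0 w hw).2 _ (hx0 w hw).1 (mem_cell_cellOf _)) h4.symm
    change G (S.cellOf (η w)) w = G (S.cellOf (η u)) u
    rw [hc] at hdir ⊢
    simp only [G]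
    rw [hdir, smul_smul, div_eq_mul_inv, ← mul_assoc, inv_mul_cancel₀ hw.1.ne', one_mul]
  have hhalf : b' / 2 ∈ Ioo 0 b' := ⟨by positivity, by linarith⟩
  let f := S.cellOf (η (b' / 2))
  let e := (b' / 2)⁻¹ • (S.pos f (η (b' / 2)) - S.pos f x)
  have hxf := (hx0 _ hhalf).1
  refine ⟨f, e, hxf, ?_, ?_⟩
  · rw [norm_smul, (hx0 _ hhalf).2 f hxf (mem_cell_cellOf _), norm_inv, Real.norm_eq_abs,
      abs_of_pos hhalf.1, inv_mul_cancel₀ hhalf.1.ne']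
  · filter_upwards [Ioo_mem_nhdsGT hb'] with u hu
    have h1 : F u = ⟨f, e⟩ := eq_of_eventually_eq_on_Ioo hF hu hhalf
    have hc : S.cellOf (η u) = f := congrArg Sigma.fst h1
    have h2 : G (S.cellOf (η u)) u = ⟨f, e⟩ := h1
    rw [hc] at h2
    have h3 : u⁻¹ • (S.pos f (η u) - S.pos f x) = e := eq_of_heq (Sigma.mk.inj h2).2
    have hop : η u ∈ S.openCell f := hc ▸ mem_openCell_cellOf (η u)
    have h4 : S.pos f x + u • e = S.pos f (η u) := by
      rw [← h3, smul_smul, mul_inv_cancel₀ hu.1.ne', one_smul]; abel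
    rw [h4]
    exact ⟨pos_mem_interior hop, chart_pos (openCell_subset_cell _ hop)⟩

theorem IsRay.cell_subset {x : S.Carrier} {η : ℝ → S.Carrier} {f : S.Face} {e : S.Tangent f}
    (h : IsRay x η f e) : S.cell (S.cellOf x) ⊆ S.cell f := cell_subset_of_mem h.mem

theorem IsRay.eventually_cellOf {x : S.Carrier} {η : ℝ → S.Carrier} {f : S.Face} {e : S.Tangent f}
    (h : IsRay x η f e) : ∀ᶠ u in 𝓝[>] (0 : ℝ), S.cellOf (η u) = f := by
  filter_upwards [h.eventually] with u hu
  rw [← hu.2, cellOf_chart hu.1]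

/-- A ray whose direction is tangent to the smallest cell at its origin stays in that cell. -/
theorem IsRay.eq_cellOf {x : S.Carrier} {η : ℝ → S.Carrier} {f : S.Face} {e : S.Tangent f}
    (h : IsRay x η f e) {g : S.Face} (hg : g = S.cellOf x) (hgf : S.cell g ⊆ S.cell f)
    {v : S.Tangent g} (hv : (emb hgf).linearIsometry v = e) : f = S.cellOf x := by
  subst hg
  obtain ⟨u, hu, hu'⟩ := (((eventually_add_smul_mem_interior (pos_cellOf_mem_interior x)
    v).filter_mono nhdsWithin_le_nhds).and h.eventually).exists
  have h1 := chart_emb hgf (interior_subset hu)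
  rw [affineIsometry_apply _ (S.pos _ x), add_sub_cancel_left, map_smul, hv,
    emb_pos hgf (mem_cell_cellOf x)] at h1
  rw [← cellOf_chart hu'.1, h1, cellOf_chart hu]

theorem norm_sub_smul_le {E : Type*} [NormedAddCommGroup E] [InnerProductSpace ℝ E] {e v : E}
    (he : ‖e‖ = 1) {u : ℝ} (hu : 0 < u) (s : ℝ) :
    ‖u • e - s • v‖ ≤ u - s * inner ℝ v e + s ^ 2 * ‖v‖ ^ 2 / (2 * u) := by
  have h1 : ‖u • e - s • v‖ ^ 2 = u ^ 2 - 2 * u * (s * inner ℝ v e) + s ^ 2 * ‖v‖ ^ 2 := by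
    rw [norm_sub_sq_real, norm_smul, norm_smul, he, inner_smul_left, inner_smul_right,
      real_inner_comm v e, mul_pow, mul_pow, Real.norm_eq_abs, Real.norm_eq_abs, sq_abs, sq_abs]
    simp only [conj_trivial]
    ring
  have h2 : 2 * u * ‖u • e - s • v‖ ≤ ‖u • e - s • v‖ ^ 2 + u ^ 2 := by
    nlinarith [sq_nonneg (‖u • e - s • v‖ - u)]
  rw [h1] at h2
  have h3 : u - s * inner ℝ v e + s ^ 2 * ‖v‖ ^ 2 / (2 * u) =
      (u ^ 2 - 2 * u * (s * inner ℝ v e) + s ^ 2 * ‖v‖ ^ 2 + u ^ 2) / (2 * u) := by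
    field_simp; ring
  rw [h3, le_div_iff₀ (by positivity)]
  linarith

/-- First variation: along a shortest path through `x` the two directions at `x` have opposite
components along the smallest cell that contains `x`. -/
theorem inner_add_inner_eq_zero {x : S.Carrier} {η η' : ℝ → S.Carrier} {f f' : S.Face}
    {e : S.Tangent f} {e' : S.Tangent f'} (h : IsRay x η f e) (h' : IsRay x η' f' e')
    (hd : ∀ᶠ u in 𝓝[>] (0 : ℝ), edist (η u) (η' u) = ENNReal.ofReal (2 * u))
    (hf : S.cell (S.cellOf x) ⊆ S.cell f) (hf' : S.cell (S.cellOf x) ⊆ S.cell f')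
    (v : S.Tangent (S.cellOf x)) :
    inner ℝ ((emb hf).linearIsometry v) e + inner ℝ ((emb hf').linearIsometry v) e' = 0 := by
  obtain ⟨u, ⟨⟨⟨hu1, hu2⟩, hu1', hu2'⟩, hud⟩, hu0⟩ :=
    (((h.eventually.and h'.eventually).and hd).and self_mem_nhdsWithin).exists
  have hu0 : 0 < u := hu0
  set c := inner ℝ ((emb hf).linearIsometry v) e + inner ℝ ((emb hf').linearIsometry v) e' with hc
  have hx := mem_cell_cellOf x
  have key : ∀ᶠ s in 𝓝 (0 : ℝ), s * c ≤ s ^ 2 * (‖v‖ ^ 2 / u) := by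
    filter_upwards [eventually_add_smul_mem_interior (pos_cellOf_mem_interior x) v] with s hs
    have hz := interior_subset hs
    set z := S.pos (S.cellOf x) x + s • v with hzdef
    have hpt : ∀ {k : S.Face} (hk : S.cell (S.cellOf x) ⊆ S.cell k),
        emb hk z = S.pos k x + s • (emb hk).linearIsometry v := by
      intro k hk
      rw [hzdef, affineIsometry_apply _ (S.pos (S.cellOf x) x), add_sub_cancel_left, map_smul,
        emb_pos hk hx]
    have h1 := edist_chart_le (interior_subset hu1) (emb_mem hf hz)
    have h2 := edist_chart_le (interior_subset hu1') (emb_mem hf' hz)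
    rw [chart_emb hf hz, hu2, hpt hf, add_sub_add_left_eq_sub] at h1
    rw [chart_emb hf' hz, hu2', hpt hf', add_sub_add_left_eq_sub] at h2
    have h3 := edist_triangle_right (η u) (η' u) (S.chart _ z)
    rw [hud] at h3
    have h4 := h3.trans (add_le_add h1 h2)
    rw [← ENNReal.ofReal_add (norm_nonneg _) (norm_nonneg _),
      ENNReal.ofReal_le_ofReal_iff (by positivity)] at h4
    have h5 := norm_sub_smul_le (v := (emb hf).linearIsometry v) h.norm_eq hu0 s
    have h6 := norm_sub_smul_le (v := (emb hf').linearIsometry v) h'.norm_eq hu0 s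
    rw [LinearIsometry.norm_map] at h5 h6
    have h7 : s ^ 2 * ‖v‖ ^ 2 / (2 * u) + s ^ 2 * ‖v‖ ^ 2 / (2 * u) = s ^ 2 * (‖v‖ ^ 2 / u) := by
      field_simp; ring
    rw [hc, mul_add]
    linarith
  have hlim : Tendsto (fun s : ℝ => s * (‖v‖ ^ 2 / u)) (𝓝 0) (𝓝 0) :=
    Continuous.tendsto' (by fun_prop) 0 0 (zero_mul _)
  have hcle : c ≤ 0 := by
    refine ge_of_tendsto (hlim.mono_left (nhdsWithin_le_nhds (s := Ioi 0))) ?_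
    filter_upwards [key.filter_mono nhdsWithin_le_nhds, self_mem_nhdsWithin] with s hs hs0
    have hs0 : 0 < s := hs0
    have h1 : s * c ≤ s * (s * (‖v‖ ^ 2 / u)) := by rw [← mul_assoc, ← pow_two]; exact hs
    exact le_of_mul_le_mul_left h1 hs0
  have hcge : 0 ≤ c := by
    refine le_of_tendsto (hlim.mono_left (nhdsWithin_le_nhds (s := Iio 0))) ?_
    filter_upwards [key.filter_mono nhdsWithin_le_nhds, self_mem_nhdsWithin] with s hs hs0
    have hs0 : s < 0 := hs0
    have h1 : s * c ≤ s * (s * (‖v‖ ^ 2 / u)) := by rw [← mul_assoc, ← pow_two]; exact hs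
    exact (mul_le_mul_left_of_neg hs0).1 h1
  exact le_antisymm hcle hcge

end PolyhedralComplex

theorem eventually_nhdsGT_zero_iff {P : ℝ → Prop} :
    (∀ᶠ u in 𝓝[>] (0 : ℝ), P u) ↔ ∃ ε > 0, ∀ u ∈ Ioo 0 ε, P u := by
  rw [eventually_iff, mem_nhdsGT_iff_exists_Ioo_subset]
  rfl

theorem eventually_nhds_of_add_of_sub {P : ℝ → Prop} {t : ℝ}
    (h : ∀ᶠ u in 𝓝[>] (0 : ℝ), P (t + u)) (h' : ∀ᶠ u in 𝓝[>] (0 : ℝ), P (t - u)) (ht : P t) :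
    ∀ᶠ s in 𝓝 t, P s := by
  obtain ⟨ε, hε, H⟩ := eventually_nhdsGT_zero_iff.1 h
  obtain ⟨ε', hε', H'⟩ := eventually_nhdsGT_zero_iff.1 h'
  filter_upwards [Ioo_mem_nhds (sub_lt_self t hε') (lt_add_of_pos_right t hε)] with s hs
  rcases lt_trichotomy s t with hst | rfl | hst
  · have := H' (t - s) ⟨by linarith, by linarith [hs.1]⟩
    rwa [sub_sub_cancel] at this
  · exact ht
  · have := H (s - t) ⟨by linarith, by linarith [hs.2]⟩
    rwa [add_sub_cancel] at this

/-- A function that is locally affine on an open interval is affine there. -/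
theorem exists_affine_of_locally_affine {F : ℝ → ℝ} {a b : ℝ}
    (h : ∀ t ∈ Ioo a b, ∃ β c : ℝ, ∀ᶠ s in 𝓝 t, F s = β * s + c) :
    ∃ β c : ℝ, ∀ t ∈ Ioo a b, F t = β * t + c := by
  rcases (Ioo a b).eq_empty_or_nonempty with he | ⟨t₀, ht₀⟩
  · exact ⟨0, 0, by simp [he]⟩
  have hderiv : ∀ {t β c : ℝ}, (∀ᶠ s in 𝓝 t, F s = β * s + c) → ∀ᶠ s in 𝓝 t, deriv F s = β := by
    intro t β c hF
    filter_upwards [hF.eventually_nhds] with s hs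
    rw [EventuallyEq.deriv_eq (f := fun s => β * s + c) hs]
    simp
  have hconst : ∀ t ∈ Ioo a b, deriv F t = deriv F t₀ := fun t ht => by
    refine eq_of_eventually_eq_on_Ioo (F := deriv F) (fun s hs => ?_) ht ht₀
    obtain ⟨β, c, hF⟩ := h s hs
    have := hderiv hF
    filter_upwards [this] with x hx
    rw [hx, this.self_of_nhds]
  refine ⟨deriv F t₀, F t₀ - deriv F t₀ * t₀, fun t ht => ?_⟩
  have : F t - deriv F t₀ * t = F t₀ - deriv F t₀ * t₀ := by
    refine eq_of_eventually_eq_on_Ioo (F := fun t => F t - deriv F t₀ * t) (fun s hs => ?_) ht ht₀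
    obtain ⟨β, c, hF⟩ := h s hs
    have h1 := (hderiv hF).self_of_nhds
    rw [hconst s hs] at h1
    filter_upwards [hF] with x hx
    rw [hx, hF.self_of_nhds, h1]
    ring
  linarith

theorem norm_add_smul_sq {E : Type*} [NormedAddCommGroup E] [InnerProductSpace ℝ E] {w e : E}
    (he : ‖e‖ = 1) (u : ℝ) : ‖w + u • e‖ ^ 2 = u ^ 2 + 2 * u * inner ℝ w e + ‖w‖ ^ 2 := by
  rw [norm_add_sq_real, norm_smul, inner_smul_right, he, Real.norm_eq_abs, mul_one, sq_abs]
  ring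

namespace PolyhedralComplex
variable {S : PolyhedralComplex}

/-- The path `γ` is a straight segment on either side of the time `t`, with matching directions. -/
def IsStraightAt (γ : ℝ → S.Carrier) (t : ℝ) : Prop :=
  ∃ f e f' e', IsRay (γ t) (fun u => γ (t + u)) f e ∧ IsRay (γ t) (fun u => γ (t - u)) f' e' ∧
    ∀ (hf : S.cell (S.cellOf (γ t)) ⊆ S.cell f) (hf' : S.cell (S.cellOf (γ t)) ⊆ S.cell f')
      (v : S.Tangent (S.cellOf (γ t))),
      inner ℝ ((emb hf).linearIsometry v) e + inner ℝ ((emb hf').linearIsometry v) e' = 0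

/-- The path `γ` changes its open cell at the time `t`. -/
def IsBreak (γ : ℝ → S.Carrier) (t : ℝ) : Prop :=
  ¬ ∀ᶠ s in 𝓝 t, S.cellOf (γ s) = S.cellOf (γ t)

/-- The metric along `γ` on `[0, r]` is the parameter distance. -/
def IsGeodesicOn (γ : ℝ → S.Carrier) (r : ℝ) : Prop :=
  ∀ s ∈ Icc 0 r, ∀ t ∈ Icc 0 r, edist (γ s) (γ t) = ENNReal.ofReal |s - t|

theorem IsShortestPath.isGeodesicOn {γ : ℝ → S.Carrier} {r : ℝ} (h : S.IsShortestPath γ r) :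
    IsGeodesicOn γ r := by
  have h0 : (0 : ℝ) ∈ Icc 0 r := ⟨le_rfl, h.nonneg⟩
  have hr : r ∈ Icc 0 r := ⟨h.nonneg, le_rfl⟩
  have hle : ∀ s ∈ Icc 0 r, ∀ t ∈ Icc 0 r, s ≤ t →
      edist (γ s) (γ t) ≤ ENNReal.ofReal (t - s) := by
    intro s hs t ht hst
    have h1 := h.arclength hs ht
    rw [NNReal.coe_one, one_mul] at h1
    rw [← h1]
    exact eVariationOn.edist_le γ ⟨hs, le_rfl, hst⟩ ⟨ht, hst, le_rfl⟩
  have htot : edist (γ 0) (γ r) = ENNReal.ofReal r := by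
    rw [← h.length_eq]
    have h1 := h.arclength h0 hr
    rwa [NNReal.coe_one, one_mul, inter_self, sub_zero] at h1
  have heq : ∀ s ∈ Icc 0 r, ∀ t ∈ Icc 0 r, s ≤ t →
      edist (γ s) (γ t) = ENNReal.ofReal (t - s) := by
    intro s hs t ht hst
    refine le_antisymm (hle s hs t ht hst) ?_
    have h1 := hle 0 h0 s hs hs.1
    have h2 := hle t ht r hr ht.2
    have h3 : edist (γ 0) (γ r) ≤ edist (γ 0) (γ s) + edist (γ s) (γ t) + edist (γ t) (γ r) :=
      edist_triangle4 _ _ _ _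
    have h4 : edist (γ s) (γ t) ≠ ⊤ := ((hle s hs t ht hst).trans_lt ENNReal.ofReal_lt_top).ne
    rw [htot] at h3
    have h5 := h3.trans (add_le_add (add_le_add_left h1 _) h2)
    rw [← ENNReal.ofReal_toReal h4, sub_zero,
      ← ENNReal.ofReal_add hs.1 ENNReal.toReal_nonneg,
      ← ENNReal.ofReal_add (add_nonneg hs.1 ENNReal.toReal_nonneg) (by linarith [ht.2]),
      ENNReal.ofReal_le_ofReal_iff (by linarith [hs.1, ht.2, ENNReal.toReal_nonneg (a := edist (γ s) (γ t))])] at h5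
    rw [← ENNReal.ofReal_toReal h4]
    exact ENNReal.ofReal_le_ofReal (by linarith)
  intro s hs t ht
  rcases le_total s t with hst | hst
  · rw [heq s hs t ht hst, abs_sub_comm, abs_of_nonneg (sub_nonneg.2 hst)]
  · rw [edist_comm, heq t ht s hs hst, abs_of_nonneg (sub_nonneg.2 hst)]

theorem IsGeodesicOn.exists_right_ray {γ : ℝ → S.Carrier} {r t : ℝ} (h : IsGeodesicOn γ r)
    (ht : t ∈ Ico 0 r) : ∃ f e, IsRay (γ t) (fun u => γ (t + u)) f e := by
  have := exists_isRay (η := fun u => γ (t + u)) (b := r - t) (sub_pos.2 ht.2)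
    fun u hu w hw => by
      rw [h _ ⟨by linarith [ht.1, hu.1], by linarith [hu.2]⟩ _
        ⟨by linarith [ht.1, hw.1], by linarith [hw.2]⟩, add_sub_add_left_eq_sub]
  simpa only [add_zero] using this

theorem IsGeodesicOn.exists_left_ray {γ : ℝ → S.Carrier} {r t : ℝ} (h : IsGeodesicOn γ r)
    (ht : t ∈ Ioc 0 r) : ∃ f e, IsRay (γ t) (fun u => γ (t - u)) f e := by
  have := exists_isRay (η := fun u => γ (t - u)) (b := t) ht.1
    fun u hu w hw => by
      rw [h _ ⟨by linarith [hu.2], by linarith [hu.1, ht.2]⟩ _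
        ⟨by linarith [hw.2], by linarith [hw.1, ht.2]⟩, sub_sub_sub_cancel_left, abs_sub_comm]
  simpa only [sub_zero] using this

theorem IsGeodesicOn.isStraightAt {γ : ℝ → S.Carrier} {r t : ℝ} (h : IsGeodesicOn γ r)
    (ht : t ∈ Ioo 0 r) : IsStraightAt γ t := by
  obtain ⟨f, e, hr⟩ := h.exists_right_ray ⟨ht.1.le, ht.2⟩
  obtain ⟨f', e', hl⟩ := h.exists_left_ray ⟨ht.1, ht.2.le⟩
  refine ⟨f, e, f', e', hr, hl, inner_add_inner_eq_zero hr hl ?_⟩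
  filter_upwards [Ioo_mem_nhdsGT (lt_min ht.1 (sub_pos.2 ht.2))] with u hu
  have h1 := hu.2.trans_le (min_le_left _ _)
  have h2 := hu.2.trans_le (min_le_right _ _)
  rw [h _ ⟨by linarith [hu.1, ht.1], by linarith⟩ _ ⟨by linarith, by linarith [hu.1, ht.2]⟩,
    show t + u - (t - u) = 2 * u by ring, abs_of_pos (by linarith [hu.1])]

/-- A path whose direction at `t` is tangent to the cell at the time `t` stays in this cell. -/
theorem not_isBreak_of_tangent {γ : ℝ → S.Carrier} {t : ℝ} {f f' : S.Face} {e : S.Tangent f}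
    {e' : S.Tangent f'} (h : IsRay (γ t) (fun u => γ (t + u)) f e)
    (h' : IsRay (γ t) (fun u => γ (t - u)) f' e')
    (hb : ∀ (hf : S.cell (S.cellOf (γ t)) ⊆ S.cell f) (hf' : S.cell (S.cellOf (γ t)) ⊆ S.cell f')
      (v : S.Tangent (S.cellOf (γ t))),
      inner ℝ ((emb hf).linearIsometry v) e + inner ℝ ((emb hf').linearIsometry v) e' = 0)
    (hf : S.cell (S.cellOf (γ t)) ⊆ S.cell f) {v : S.Tangent (S.cellOf (γ t))}
    (hv : (emb hf).linearIsometry v = e) : ¬ IsBreak γ t := by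
  have h1 := h.eq_cellOf rfl hf hv
  have hf' := h'.cell_subset
  have hv1 : ‖v‖ = 1 := by rw [← (emb hf).linearIsometry.norm_map, hv, h.norm_eq]
  have hv' : (emb hf').linearIsometry (-v) = e' := by
    refine (inner_eq_one_iff_of_norm_eq_one (𝕜 := ℝ) ?_ h'.norm_eq).1 ?_
    · rw [LinearIsometry.norm_map, norm_neg, hv1]
    · have := hb hf hf' v
      rw [hv, real_inner_self_eq_norm_sq, h.norm_eq] at this
      rw [map_neg, inner_neg_left]
      linarith
  have h2 := h'.eq_cellOf rfl hf' hv'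
  rw [IsBreak, not_not]
  refine eventually_nhds_of_add_of_sub ?_ ?_ rfl
  · filter_upwards [h.eventually_cellOf] with u hu
    rw [hu, h1]
  · filter_upwards [h'.eventually_cellOf] with u hu
    rw [hu, h2]

open Classical in
/-- The squared distance, in a cell that contains `x` and `G`, from `x` to the point `z` of the
affine span of `G`. -/
noncomputable def sqDist (G : S.Face) (z : S.Tangent G) (x : S.Carrier) : ℝ :=
  if h : S.cell G ⊆ S.cell (S.cellOf x) then ‖S.pos (S.cellOf x) x - emb h z‖ ^ 2 else 0

theorem sqDist_eq {G : S.Face} (z : S.Tangent G) {x : S.Carrier}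
    (hG : S.cell G ⊆ S.cell (S.cellOf x)) {f : S.Face} (hf : S.cell G ⊆ S.cell f)
    (hx : x ∈ S.cell f) : sqDist G z x = ‖S.pos f x - emb hf z‖ ^ 2 := by
  have hsub := cell_subset_of_mem hx
  rw [sqDist, dif_pos hG, ← emb_pos hsub (mem_cell_cellOf x), ← emb_emb hG hsub hf,
    ← dist_eq_norm, ← dist_eq_norm, (emb hsub).dist_map]

theorem IsRay.sqDist_eq {x : S.Carrier} {η : ℝ → S.Carrier} {f : S.Face} {e : S.Tangent f}
    (h : IsRay x η f e) {G : S.Face} (z : S.Tangent G) (hf : S.cell G ⊆ S.cell f) :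
    ∀ᶠ u in 𝓝[>] (0 : ℝ), sqDist G z (η u) = ‖S.pos f x + u • e - emb hf z‖ ^ 2 := by
  filter_upwards [h.eventually] with u hu
  have hc := cellOf_chart hu.1
  rw [hu.2] at hc
  have hop := hc ▸ mem_openCell_cellOf (η u)
  rw [PolyhedralComplex.sqDist_eq z (by rw [hc]; exact hf) hf (openCell_subset_cell _ hop), ← hu.2,
    pos_chart (interior_subset hu.1)]

theorem IsRay.sqDist_eq' {x : S.Carrier} {η : ℝ → S.Carrier} {f : S.Face} {e : S.Tangent f}
    (h : IsRay x η f e) {G : S.Face} (z : S.Tangent G) (hG : S.cell G ⊆ S.cell (S.cellOf x)) :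
    ∀ᶠ u in 𝓝[>] (0 : ℝ), sqDist G z (η u) = u ^ 2 + 2 * u *
      inner ℝ ((emb h.cell_subset).linearIsometry (S.pos (S.cellOf x) x - emb hG z)) e +
      sqDist G z x := by
  filter_upwards [h.sqDist_eq z (hG.trans h.cell_subset)] with u hu
  have h1 : S.pos f x - emb (hG.trans h.cell_subset) z =
      (emb h.cell_subset).linearIsometry (S.pos (S.cellOf x) x - emb hG z) := by
    rw [← emb_pos h.cell_subset (mem_cell_cellOf x), ← emb_emb hG h.cell_subset,
      affineIsometry_apply _ (emb hG z)]
    abel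
  rw [hu, PolyhedralComplex.sqDist_eq z hG (hG.trans h.cell_subset) h.mem, ← h1,
    ← norm_add_smul_sq h.norm_eq]
  congr 2; abel

theorem IsStraightAt.exists_sqDist_eq {γ : ℝ → S.Carrier} {t : ℝ} (h : IsStraightAt γ t)
    {G : S.Face} (z : S.Tangent G) (hG : S.cell G ⊆ S.cell (S.cellOf (γ t))) :
    ∃ k : ℝ, ∀ᶠ s in 𝓝 t, sqDist G z (γ s) =
      (s - t) ^ 2 + 2 * (s - t) * k + sqDist G z (γ t) := by
  obtain ⟨f, e, f', e', hr, hl, hb⟩ := h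
  refine ⟨inner ℝ ((emb hr.cell_subset).linearIsometry
    (S.pos (S.cellOf (γ t)) (γ t) - emb hG z)) e, eventually_nhds_of_add_of_sub ?_ ?_ (by simp)⟩
  · filter_upwards [hr.sqDist_eq' z hG] with u hu
    rw [hu]; ring
  · filter_upwards [hl.sqDist_eq' z hG] with u hu
    have := hb hr.cell_subset hl.cell_subset (S.pos (S.cellOf (γ t)) (γ t) - emb hG z)
    rw [hu, eq_neg_of_add_eq_zero_left this]
    ring

theorem exists_sqDist_eq_on {γ : ℝ → S.Carrier} {a b : ℝ} {G : S.Face} (z : S.Tangent G)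
    (h : ∀ t ∈ Ioo a b, IsStraightAt γ t ∧ S.cell G ⊆ S.cell (S.cellOf (γ t))) :
    ∃ β c : ℝ, ∀ t ∈ Ioo a b, sqDist G z (γ t) = t ^ 2 + β * t + c := by
  obtain ⟨β, c, H⟩ := exists_affine_of_locally_affine
    (F := fun t => sqDist G z (γ t) - t ^ 2) (a := a) (b := b) (by
      intro t ht
      obtain ⟨k, hk⟩ := (h t ht).1.exists_sqDist_eq z (h t ht).2
      refine ⟨2 * k - 2 * t, t ^ 2 - 2 * t * k + sqDist G z (γ t), ?_⟩
      filter_upwards [hk] with s hs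
      rw [hs]; ring)
  exact ⟨β, c, fun t ht => by linarith [H t ht]⟩

/-- While `γ` stays in cells that contain `G`, its distances from the points of the affine span of
`G` are those of a straight line. -/
theorem sqDist_eq_line {γ : ℝ → S.Carrier} {a b t₀ : ℝ} {G : S.Face} (z : S.Tangent G)
    (h : ∀ t ∈ Ioo a b, IsStraightAt γ t ∧ S.cell G ⊆ S.cell (S.cellOf (γ t)))
    (ht₀ : t₀ ∈ Ico a b) {f : S.Face} {e : S.Tangent f}
    (hr : IsRay (γ t₀) (fun u => γ (t₀ + u)) f e) (hf : S.cell G ⊆ S.cell f) {t : ℝ}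
    (ht : t ∈ Ioo a b) :
    sqDist G z (γ t) = ‖S.pos f (γ t₀) + (t - t₀) • e - emb hf z‖ ^ 2 := by
  obtain ⟨β, c, H⟩ := exists_sqDist_eq_on z h
  have hline : ∀ s, ‖S.pos f (γ t₀) + (s - t₀) • e - emb hf z‖ ^ 2 = (s - t₀) ^ 2 +
      2 * (s - t₀) * inner ℝ (S.pos f (γ t₀) - emb hf z) e + ‖S.pos f (γ t₀) - emb hf z‖ ^ 2 := by
    intro s
    rw [← norm_add_smul_sq hr.norm_eq]
    congr 2; abel
  obtain ⟨ε, hε, hev⟩ := eventually_nhdsGT_zero_iff.1 (hr.sqDist_eq z hf)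
  set κ := inner ℝ (S.pos f (γ t₀) - emb hf z) e
  set m := ‖S.pos f (γ t₀) - emb hf z‖ ^ 2
  have hagree : ∀ u ∈ Ioo 0 (min ε (b - t₀)),
      (t₀ + u) ^ 2 + β * (t₀ + u) + c = u ^ 2 + 2 * u * κ + m := by
    intro u hu
    have h1 := hev u ⟨hu.1, hu.2.trans_le (min_le_left _ _)⟩
    have h2 := H (t₀ + u) ⟨by linarith [hu.1, ht₀.1],
      by linarith [hu.2.trans_le (min_le_right _ _)]⟩
    have h3 := hline (t₀ + u)
    rw [add_sub_cancel_left] at h3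
    rw [← h2, h1, h3]
  set d := min ε (b - t₀)
  have hd : 0 < d := lt_min hε (by linarith [ht₀.2])
  have h1 := hagree (d / 2) ⟨by linarith, by linarith⟩
  have h2 := hagree (d / 4) ⟨by linarith, by linarith⟩
  have hβ : β = 2 * κ - 2 * t₀ := by
    have : d * (2 * t₀ + β - 2 * κ) = 0 := by linarith
    rcases mul_eq_zero.1 this with h | h <;> linarith
  have hc : c = t₀ ^ 2 - 2 * t₀ * κ + m := by rw [hβ] at h1; linarith
  rw [H t ht, hline, hβ, hc]
  ring

theorem norm_pos_sub_eq_line {γ : ℝ → S.Carrier} {a b t₀ : ℝ} {G : S.Face} (z : S.Tangent G)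
    (h : ∀ t ∈ Ioo a b, IsStraightAt γ t ∧ S.cell G ⊆ S.cell (S.cellOf (γ t)))
    (ht₀ : t₀ ∈ Ico a b) {f : S.Face} {e : S.Tangent f}
    (hr : IsRay (γ t₀) (fun u => γ (t₀ + u)) f e) (hf : S.cell G ⊆ S.cell f) {t : ℝ}
    (ht : t ∈ Ioo a b) {k : S.Face} (hk : S.cell G ⊆ S.cell k) (htk : γ t ∈ S.cell k) :
    ‖S.pos k (γ t) - emb hk z‖ = ‖S.pos f (γ t₀) + (t - t₀) • e - emb hf z‖ := by
  have h1 := sqDist_eq_line z h ht₀ hr hf ht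
  rw [sqDist_eq z (h t ht).2 hk htk] at h1
  exact (pow_left_inj₀ (norm_nonneg _) (norm_nonneg _) two_ne_zero).1 h1

/-- While `γ` stays in cells that contain `G`, and until it exits them, the distances are those of
a straight line. If these distances forbid the exit, then `γ` stays in these cells. -/
theorem star_extend {γ : ℝ → S.Carrier} {a b : ℝ} (h : ∀ t ∈ Ioo a b, IsStraightAt γ t)
    {f : S.Face} {e : S.Tangent f} (hr : IsRay (γ a) (fun u => γ (a + u)) f e)
    {G : S.Face} (hG : S.cell G ⊆ S.cell f)
    (H : ∀ T ∈ Ioo a b, ∀ (k : S.Face) (hk : S.cell G ⊆ S.cell k), γ T ∈ S.cell k →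
      (∀ z, ‖S.pos k (γ T) - emb hk z‖ = ‖S.pos f (γ a) + (T - a) • e - emb hG z‖) →
      S.cell G ⊆ S.cell (S.cellOf (γ T))) :
    ∀ t ∈ Ioo a b, S.cell G ⊆ S.cell (S.cellOf (γ t)) := by
  by_contra! hcon
  obtain ⟨t₁, ht₁, hbad₁⟩ := hcon
  let A := {t | t ∈ Ioo a b ∧ ¬ S.cell G ⊆ S.cell (S.cellOf (γ t))}
  have hAne : A.Nonempty := ⟨t₁, ht₁, hbad₁⟩
  have hAbd : BddBelow A := ⟨a, fun t ht => ht.1.1.le⟩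
  obtain ⟨ε, hε, hev⟩ := eventually_nhdsGT_zero_iff.1 hr.eventually_cellOf
  set T := sInf A with hT
  have haT : a + ε ≤ T := by
    refine le_csInf hAne fun t ht => ?_
    by_contra! hlt
    have := hev (t - a) ⟨sub_pos.2 ht.1.1, by linarith⟩
    rw [add_sub_cancel] at this
    exact ht.2 (this ▸ hG)
  have hTb : T ∈ Ioo a b := ⟨by linarith, (csInf_le hAbd ⟨ht₁, hbad₁⟩).trans_lt ht₁.2⟩
  have hgood : ∀ t ∈ Ioo a T, IsStraightAt γ t ∧ S.cell G ⊆ S.cell (S.cellOf (γ t)) := by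
    intro t ht
    have htb : t ∈ Ioo a b := ⟨ht.1, ht.2.trans hTb.2⟩
    refine ⟨h t htb, ?_⟩
    by_contra hnot
    exact absurd (csInf_le hAbd ⟨htb, hnot⟩) (not_le.2 ht.2)
  obtain ⟨k₂, e₂, k, e', hr₂, hl, -⟩ := h T hTb
  have hk : S.cell G ⊆ S.cell k := by
    obtain ⟨u, hu, hu'⟩ := (hl.eventually_cellOf.and
      (Ioo_mem_nhdsGT (sub_pos.2 hTb.1))).exists
    rw [← hu]
    exact (hgood (T - u) ⟨by linarith [hu'.2], by linarith [hu'.1]⟩).2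
  have hTG : S.cell G ⊆ S.cell (S.cellOf (γ T)) := by
    refine H T hTb k hk hl.mem fun z => ?_
    have heq : ∀ᶠ u in 𝓝[>] (0 : ℝ), ‖S.pos k (γ T) + u • e' - emb hk z‖ ^ 2 =
        ‖S.pos f (γ a) + (T - u - a) • e - emb hG z‖ ^ 2 := by
      filter_upwards [hl.sqDist_eq z hk, Ioo_mem_nhdsGT (sub_pos.2 hTb.1)] with u hu hu'
      rw [← hu]
      exact sqDist_eq_line z hgood ⟨le_rfl, hTb.1⟩ hr hG
        ⟨by linarith [hu'.2], by linarith [hu'.1]⟩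
    have hc1 : Tendsto (fun u : ℝ => ‖S.pos k (γ T) + u • e' - emb hk z‖ ^ 2) (𝓝[>] 0)
        (𝓝 (‖S.pos k (γ T) - emb hk z‖ ^ 2)) :=
      (Continuous.tendsto' (by fun_prop) 0 _ (by simp)).mono_left nhdsWithin_le_nhds
    have hc2 : Tendsto (fun u : ℝ => ‖S.pos f (γ a) + (T - u - a) • e - emb hG z‖ ^ 2) (𝓝[>] 0)
        (𝓝 (‖S.pos f (γ a) + (T - a) • e - emb hG z‖ ^ 2)) :=
      (Continuous.tendsto' (by fun_prop) 0 _ (by simp)).mono_left nhdsWithin_le_nhds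
    have := tendsto_nhds_unique (hc1.congr' heq) hc2
    exact (pow_left_inj₀ (norm_nonneg _) (norm_nonneg _) two_ne_zero).1 this
  obtain ⟨ε', hε', hev'⟩ := eventually_nhdsGT_zero_iff.1 hr₂.eventually_cellOf
  obtain ⟨t, ht, htlt⟩ := exists_lt_of_csInf_lt hAne (lt_add_of_pos_right T hε')
  rcases (csInf_le hAbd ht).eq_or_lt with heq | hlt
  · exact ht.2 (heq ▸ hTG)
  · have := hev' (t - T) ⟨sub_pos.2 hlt, by linarith⟩
    rw [add_sub_cancel] at this
    exact ht.2 (this ▸ hTG.trans hr₂.cell_subset)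

/-- While `γ` stays in cells that contain `G`, it changes its cell only where it meets the relative
interior of `G`, if it does so at all. -/
theorem eq_of_isBreak_of_cellOf_eq {γ : ℝ → S.Carrier} {a b : ℝ} {G : S.Face}
    (h : ∀ t ∈ Ioo a b, IsStraightAt γ t ∧ S.cell G ⊆ S.cell (S.cellOf (γ t))) {t₀ : ℝ}
    (ht₀ : t₀ ∈ Ioo a b) (hG : S.cellOf (γ t₀) = G) {t : ℝ} (ht : t ∈ Ioo a b)
    (hbr : IsBreak γ t) : t = t₀ := by
  by_contra hne
  have hne' : t - t₀ ≠ 0 := sub_ne_zero.2 hne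
  subst hG
  set G := S.cellOf (γ t₀)
  set z := S.pos G (γ t₀)
  obtain ⟨f₀, e₀, -, -, hr₀, -⟩ := (h t₀ ht₀).1
  have hD : ∀ s ∈ Ioo a b, sqDist G z (γ s) = (s - t₀) ^ 2 := by
    intro s hs
    rw [sqDist_eq_line z h ⟨ht₀.1.le, ht₀.2⟩ hr₀ hr₀.cell_subset hs,
      emb_pos hr₀.cell_subset (mem_cell_cellOf _), add_sub_cancel_left, norm_smul, hr₀.norm_eq,
      mul_one, Real.norm_eq_abs, sq_abs]
  obtain ⟨f, e, f', e', hr, hl, hb⟩ := (h t ht).1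
  have hGt := (h t ht).2
  set w := S.pos (S.cellOf (γ t)) (γ t) - emb hGt z with hw
  have hwn : ‖w‖ ^ 2 = (t - t₀) ^ 2 := by
    rw [hw, ← sqDist_eq z hGt hGt (mem_cell_cellOf _), hD t ht]
  have hwe : inner ℝ ((emb hr.cell_subset).linearIsometry w) e = t - t₀ := by
    obtain ⟨u, ⟨hu, hu'⟩⟩ := ((hr.sqDist_eq' z hGt).and (Ioo_mem_nhdsGT (sub_pos.2 ht.2))).exists
    rw [hD t ht, hD (t + u) ⟨by linarith [hu'.1, ht.1], by linarith [hu'.2]⟩] at hu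
    have h1 : u * (inner ℝ ((emb hr.cell_subset).linearIsometry w) e - (t - t₀)) = 0 := by
      linarith
    rcases mul_eq_zero.1 h1 with h1 | h1
    · exact absurd h1 hu'.1.ne'
    · linarith
  refine not_isBreak_of_tangent hr hl hb hr.cell_subset (v := (t - t₀)⁻¹ • w) ?_ hbr
  refine (inner_eq_one_iff_of_norm_eq_one (𝕜 := ℝ) ?_ hr.norm_eq).1 ?_
  · rw [LinearIsometry.norm_map, norm_smul, norm_inv, Real.norm_eq_abs,
      ← (sq_eq_sq₀ (norm_nonneg w) (abs_nonneg _)).1 (hwn.trans (sq_abs _).symm),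
      inv_mul_cancel₀]
    intro h0
    rw [h0] at hwn
    exact hne' (pow_eq_zero_iff two_ne_zero |>.1 (by rw [← hwn]; norm_num))
  · rw [map_smul, inner_smul_left, hwe]
    simp [hne']

end PolyhedralComplex

section Perp
variable {U V W W' : Type*} [NormedAddCommGroup U] [InnerProductSpace ℝ U] [FiniteDimensional ℝ U]
  [NormedAddCommGroup V] [InnerProductSpace ℝ V]
  [NormedAddCommGroup W] [InnerProductSpace ℝ W] [NormedAddCommGroup W'] [InnerProductSpace ℝ W']

/-- The component of `q` orthogonal to the range of `N`. -/
noncomputable def perp (N : U →ₗᵢ[ℝ] W) (q : W) : W :=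
  q - (LinearMap.range N.toLinearMap).starProjection q

theorem perp_add_smul (N : U →ₗᵢ[ℝ] W) (p q : W) (s : ℝ) :
    perp N (p + s • q) = perp N p + s • perp N q := by
  simp only [perp, map_add, map_smul, smul_sub]; abel

theorem inner_perp (N : U →ₗᵢ[ℝ] W) (q : W) (u : U) : inner ℝ (perp N q) (N u) = 0 :=
  Submodule.starProjection_inner_eq_zero q _ (LinearMap.mem_range_self N.toLinearMap u)

theorem exists_eq_add_perp (N : U →ₗᵢ[ℝ] W) (q : W) : ∃ y : U, q = N y + perp N q := by
  obtain ⟨y, hy⟩ := Submodule.starProjection_apply_mem (LinearMap.range N.toLinearMap) q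
  have hy' : N y = (LinearMap.range N.toLinearMap).starProjection q := hy
  exact ⟨y, by rw [hy', perp]; abel⟩

theorem inner_eq_of_norm_sub_eq {L : V →ₗᵢ[ℝ] W} {L' : V →ₗᵢ[ℝ] W'} {q : W} {q' : W'}
    (h : ∀ v, ‖q - L v‖ = ‖q' - L' v‖) (v : V) : inner ℝ q (L v) = inner ℝ q' (L' v) := by
  have h0 := h 0
  rw [map_zero, map_zero, sub_zero, sub_zero] at h0
  have h1 := congrArg (· ^ 2) (h v)
  simp only [norm_sub_sq_real, LinearIsometry.norm_map, h0] at h1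
  linarith

theorem exists_eq_add_perp_and_eq_add_perp {N : U →ₗᵢ[ℝ] W} {N' : U →ₗᵢ[ℝ] W'} {q : W} {q' : W'}
    (h : ∀ v, ‖q - N v‖ = ‖q' - N' v‖) : ∃ y : U, q = N y + perp N q ∧ q' = N' y + perp N' q' := by
  obtain ⟨y, hy⟩ := exists_eq_add_perp N q
  obtain ⟨y', hy'⟩ := exists_eq_add_perp N' q'
  have : y = y' := by
    refine ext_inner_right ℝ fun u => ?_
    have h1 := inner_eq_of_norm_sub_eq h u
    rw [hy, hy', inner_add_left, inner_add_left, inner_perp, inner_perp, add_zero, add_zero,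
      N.inner_map_map, N'.inner_map_map] at h1
    exact h1
  exact ⟨y, hy, this ▸ hy'⟩

theorem inner_perp_eq {N : U →ₗᵢ[ℝ] W} {N' : U →ₗᵢ[ℝ] W'} {M : U →ₗᵢ[ℝ] V} {L : V →ₗᵢ[ℝ] W}
    {L' : V →ₗᵢ[ℝ] W'} (hN : ∀ u, N u = L (M u)) (hN' : ∀ u, N' u = L' (M u)) {q : W} {q' : W'}
    (h : ∀ v, ‖q - L v‖ = ‖q' - L' v‖) (v : V) :
    inner ℝ (perp N q) (L v) = inner ℝ (perp N' q') (L' v) := by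
  obtain ⟨y, hy, hy'⟩ := exists_eq_add_perp_and_eq_add_perp (N := N) (N' := N')
    (fun u => by rw [hN, hN']; exact h _)
  have h1 := inner_eq_of_norm_sub_eq h v
  rw [hy, hy', inner_add_left, inner_add_left, hN, hN', L.inner_map_map, L'.inner_map_map] at h1
  exact add_left_cancel h1

theorem inner_eq_add_inner_perp (N : U →ₗᵢ[ℝ] W) {y z : U} {p q : W} (hp : p = N y + perp N p)
    (hq : q = N z + perp N q) : inner ℝ p q = inner ℝ y z + inner ℝ (perp N p) (perp N q) := by
  conv_lhs => rw [hp, hq]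
  rw [inner_add_left, inner_add_right, inner_add_right, inner_perp, N.inner_map_map,
    real_inner_comm (perp N q), inner_perp]
  ring

theorem inner_perp_perp_eq {N : U →ₗᵢ[ℝ] W} {N' : U →ₗᵢ[ℝ] W'} {p q : W} {p' q' : W'}
    (hp : ∀ v, ‖p - N v‖ = ‖p' - N' v‖) (hq : ∀ v, ‖q - N v‖ = ‖q' - N' v‖)
    (hpq : ‖p - q‖ = ‖p' - q'‖) :
    inner ℝ (perp N p) (perp N q) = inner ℝ (perp N' p') (perp N' q') := by
  obtain ⟨y, hy, hy'⟩ := exists_eq_add_perp_and_eq_add_perp hp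
  obtain ⟨z, hz, hz'⟩ := exists_eq_add_perp_and_eq_add_perp hq
  have hp0 := hp 0
  have hq0 := hq 0
  simp only [map_zero, sub_zero] at hp0 hq0
  have h1 : inner ℝ p q = inner ℝ p' q' := by
    have h1 := congrArg (· ^ 2) hpq
    simp only [norm_sub_sq_real, hp0, hq0] at h1
    linarith
  rw [inner_eq_add_inner_perp N hy hz, inner_eq_add_inner_perp N' hy' hz'] at h1
  exact add_left_cancel h1

theorem norm_perp_eq {N : U →ₗᵢ[ℝ] W} {N' : U →ₗᵢ[ℝ] W'} {q : W} {q' : W'}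
    (h : ∀ v, ‖q - N v‖ = ‖q' - N' v‖) : ‖perp N q‖ = ‖perp N' q'‖ := by
  have := inner_perp_perp_eq h h (by simp)
  rw [real_inner_self_eq_norm_sq, real_inner_self_eq_norm_sq] at this
  exact (pow_left_inj₀ (norm_nonneg _) (norm_nonneg _) two_ne_zero).1 this

theorem norm_sub_sq_of_inner {w : W} {c : ℝ} (hw : w ≠ 0) (hc : 0 ≤ c) (v : W) :
    ‖(c / ‖w‖) • w - v‖ ^ 2 = c ^ 2 - 2 * (c / ‖w‖) * inner ℝ w v + ‖v‖ ^ 2 := by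
  rw [norm_sub_sq_real, norm_smul, inner_smul_left, Real.norm_eq_abs,
    abs_of_nonneg (by positivity), div_mul_cancel₀ c (norm_ne_zero_iff.2 hw)]
  simp only [conj_trivial]
  ring

theorem norm_smul_sub_smul_sq {w w' : W} (hw : w ≠ 0) (hw' : w' ≠ 0) :
    ‖(1 / ‖w‖) • w - (1 / ‖w'‖) • w'‖ ^ 2 = 2 - 2 * (inner ℝ w w' / (‖w‖ * ‖w'‖)) := by
  have hn := norm_ne_zero_iff.2 hw
  have hn' := norm_ne_zero_iff.2 hw'
  rw [norm_sub_sq_of_inner hw zero_le_one, inner_smul_right, norm_smul, Real.norm_eq_abs,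
    abs_of_nonneg (by positivity), div_mul_cancel₀ 1 hn']
  field_simp; ring

end Perp

section Angle

theorem div_le_div_of_sq_add {p p' n n' D : ℝ} (hn : 0 < n) (hn' : 0 < n') (hD : 0 ≤ D)
    (h : n ^ 2 = p ^ 2 + D) (h' : n' ^ 2 = p' ^ 2 + D) (hpp : p ≤ p') : p / n ≤ p' / n' := by
  rw [div_le_div_iff₀ hn hn']
  rcases le_total 0 p with hp | hp
  · refine abs_le_of_sq_le_sq' ?_ (mul_nonneg (hp.trans hpp) hn.le) |>.2
    rw [mul_pow, mul_pow, h, h']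
    nlinarith [mul_le_mul hpp hpp hp (hp.trans hpp)]
  · rcases le_total 0 p' with hp' | hp'
    · exact (mul_nonpos_of_nonpos_of_nonneg hp hn'.le).trans (mul_nonneg hp' hn.le)
    · have : -p' * n ≤ -p * n' := by
        refine abs_le_of_sq_le_sq' ?_ (mul_nonneg (neg_nonneg.2 hp) hn'.le) |>.2
        rw [mul_pow, mul_pow, h, h']
        nlinarith [mul_le_mul (neg_le_neg hpp) (neg_le_neg hpp) (neg_nonneg.2 hp')
          (neg_nonneg.2 hp)]
      linarith

theorem two_sub_two_mul_div_le {p p' n n' D : ℝ} (hn : 0 < n) (hn' : 0 < n') (hD : 0 ≤ D)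
    (h : n ^ 2 = p ^ 2 + D) (h' : n' ^ 2 = p' ^ 2 + D) :
    2 - 2 * ((p * p' + D) / (n * n')) ≤ 4 * |p / n - p' / n'| := by
  set σ := p / n with hσ
  set σ' := p' / n' with hσ'
  set μ := √D / n with hμ
  set μ' := √D / n' with hμ'
  have hD2 : √D ^ 2 = D := Real.sq_sqrt hD
  have h1 : σ ^ 2 + μ ^ 2 = 1 := by
    rw [hσ, hμ, div_pow, div_pow, hD2, ← add_div, ← h, div_self (by positivity)]
  have h1' : σ' ^ 2 + μ' ^ 2 = 1 := by
    rw [hσ', hμ', div_pow, div_pow, hD2, ← add_div, ← h', div_self (by positivity)]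
  have h2 : (p * p' + D) / (n * n') = σ * σ' + μ * μ' := by
    have : D = √D * √D := by rw [← pow_two, hD2]
    conv_lhs => rw [this]
    rw [hσ, hσ', hμ, hμ']
    field_simp
  have hμ0 : 0 ≤ μ := by positivity
  have hμ0' : 0 ≤ μ' := by positivity
  have hs : |σ| ≤ 1 := abs_le_one_iff_mul_self_le_one.2 (by nlinarith)
  have hs' : |σ'| ≤ 1 := abs_le_one_iff_mul_self_le_one.2 (by nlinarith)
  have h3 : (σ - σ') ^ 2 ≤ 2 * |σ - σ'| := by
    rw [← sq_abs, pow_two]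
    exact mul_le_mul_of_nonneg_right ((abs_sub _ _).trans (by linarith)) (abs_nonneg _)
  have h4 : (μ - μ') ^ 2 ≤ 2 * |σ - σ'| := by
    calc (μ - μ') ^ 2 = |μ - μ'| * |μ - μ'| := by rw [← sq_abs, pow_two]
      _ ≤ |μ - μ'| * |μ + μ'| := by
          refine mul_le_mul_of_nonneg_left ?_ (abs_nonneg _)
          rw [abs_of_nonneg (add_nonneg hμ0 hμ0')]
          exact abs_le.2 ⟨by linarith, by linarith⟩
      _ = |σ' - σ| * |σ' + σ| := by
          rw [← abs_mul, ← abs_mul]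
          congr 1; nlinarith
      _ ≤ |σ' - σ| * 2 := by
          gcongr
          exact (abs_add_le _ _).trans (by linarith)
      _ = 2 * |σ - σ'| := by rw [abs_sub_comm]; ring
  rw [h2]
  nlinarith

/-- The directions in which the points of a line are seen from the origin fall into boundedly many
intervals of small diameter. -/
theorem exists_angular_partition {η : ℝ} (hη : 0 < η) :
    ∃ K : ℕ, ∀ {E : Type} [NormedAddCommGroup E] [InnerProductSpace ℝ E] (A B : E),
      ∃ θ : ℝ → ℕ, (∀ t, θ t < K) ∧
        (∀ s t, s ≤ t → A + s • B ≠ 0 → A + t • B ≠ 0 → θ s ≤ θ t) ∧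
        ∀ s t, A + s • B ≠ 0 → A + t • B ≠ 0 → θ s = θ t →
          ‖(1 / ‖A + s • B‖) • (A + s • B) - (1 / ‖A + t • B‖) • (A + t • B)‖ ≤ η := by
  set δ := η ^ 2 / 4 with hδ
  have hδ0 : 0 < δ := by positivity
  refine ⟨⌊2 / δ⌋₊ + 1, fun {E} _ _ A B => ?_⟩
  set w : ℝ → E := fun t => A + t • B with hw
  set D := ‖A‖ ^ 2 * ‖B‖ ^ 2 - inner ℝ A B ^ 2 with hD
  have hD0 : 0 ≤ D := by
    have := abs_real_inner_le_norm A B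
    have h2 := pow_le_pow_left₀ (abs_nonneg _) this 2
    rw [sq_abs, mul_pow] at h2
    linarith
  have hp : ∀ t, inner ℝ (w t) B = inner ℝ A B + t * ‖B‖ ^ 2 := fun t => by
    rw [hw]; simp only
    rw [inner_add_left, inner_smul_left, real_inner_self_eq_norm_sq]; simp
  have hww : ∀ s t, inner ℝ (w s) (w t) * ‖B‖ ^ 2 = inner ℝ (w s) B * inner ℝ (w t) B + D := by
    intro s t
    rw [hp, hp, hw]; simp only
    rw [inner_add_left, inner_add_right, inner_add_right, inner_smul_left, inner_smul_left,
      inner_smul_right, inner_smul_right, real_inner_self_eq_norm_sq, real_inner_self_eq_norm_sq,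
      real_inner_comm A B, hD]
    simp only [conj_trivial]
    ring
  have hn : ∀ t, (‖w t‖ * ‖B‖) ^ 2 = inner ℝ (w t) B ^ 2 + D := fun t => by
    rw [mul_pow, ← real_inner_self_eq_norm_sq (w t), hww, pow_two]
  set σ : ℝ → ℝ := fun t => inner ℝ (w t) B / (‖w t‖ * ‖B‖) with hσ
  have hσ1 : ∀ t, |σ t| ≤ 1 := fun t => abs_real_inner_div_norm_mul_norm_le_one _ _
  have hσmono : ∀ s t, s ≤ t → w s ≠ 0 → w t ≠ 0 → σ s ≤ σ t := by
    intro s t hst hs ht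
    by_cases hB : B = 0
    · simp [hσ, hB]
    have hB0 := norm_pos_iff.2 hB
    refine div_le_div_of_sq_add (mul_pos (norm_pos_iff.2 hs) hB0)
      (mul_pos (norm_pos_iff.2 ht) hB0) hD0 (hn s) (hn t) ?_
    rw [hp, hp]
    gcongr
  have hσ0 : ∀ t, 0 ≤ (σ t + 1) / δ := fun t =>
    div_nonneg (by linarith [(abs_le.1 (hσ1 t)).1]) hδ0.le
  refine ⟨fun t => ⌊(σ t + 1) / δ⌋₊, fun t => ?_, fun s t hst hs ht => ?_,
    fun s t hs ht hst => ?_⟩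
  · refine Nat.lt_succ_of_le (Nat.floor_mono ?_)
    gcongr
    linarith [(abs_le.1 (hσ1 t)).2]
  · refine Nat.floor_mono ?_
    gcongr
    exact hσmono s t hst hs ht
  · have h1 : |σ s - σ t| ≤ δ := by
      have hs1 := Nat.floor_le (hσ0 s)
      have hs2 := Nat.lt_floor_add_one ((σ s + 1) / δ)
      have ht1 := Nat.floor_le (hσ0 t)
      have ht2 := Nat.lt_floor_add_one ((σ t + 1) / δ)
      simp only at hst
      rw [hst] at hs1 hs2
      have h2 : |(σ s + 1) / δ - (σ t + 1) / δ| ≤ 1 := abs_le.2 ⟨by linarith, by linarith⟩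
      rw [← sub_div, abs_div, abs_of_pos hδ0, div_le_one hδ0] at h2
      rwa [add_sub_add_right_eq_sub] at h2
    refine abs_le_of_sq_le_sq' ?_ hη.le |>.2
    have hs' : w s ≠ 0 := hs
    have ht' : w t ≠ 0 := ht
    rw [norm_smul_sub_smul_sq hs ht]
    by_cases hB : B = 0
    · simp only [hB, smul_zero, add_zero] at hs ⊢
      rw [real_inner_self_eq_norm_mul_norm, div_self (by positivity)]
      nlinarith
    have hB0 := norm_pos_iff.2 hB
    have h2 := two_sub_two_mul_div_le (mul_pos (norm_pos_iff.2 hs') hB0)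
      (mul_pos (norm_pos_iff.2 ht') hB0) hD0 (hn s) (hn t)
    rw [← hww, show inner ℝ (w s) (w t) * ‖B‖ ^ 2 / (‖w s‖ * ‖B‖ * (‖w t‖ * ‖B‖)) =
      inner ℝ (w s) (w t) / (‖w s‖ * ‖w t‖) by field_simp] at h2
    refine h2.trans ?_
    have : 4 * |σ s - σ t| ≤ 4 * δ := by gcongr
    calc _ ≤ 4 * δ := this
      _ = η ^ 2 := by rw [hδ]; ring

end Angle

/-- A finite set of reals is bounded if it is divided into boundedly many parts in such a way that
boundedly many of its elements lie strictly between two elements of the same part. -/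
theorem card_le_of_partition {F : Finset ℝ} {θ : ℝ → ℕ} {K N : ℕ} (hK : ∀ t ∈ F, θ t < K)
    (hN : ∀ a ∈ F, ∀ b ∈ F, a < b → θ a = θ b → ∀ F' ⊆ F, (∀ t ∈ F', t ∈ Ioo a b) → F'.card ≤ N) :
    F.card ≤ (N + 2) * K := by
  classical
  have := Finset.card_le_mul_card_image_of_maps_to (s := F) (f := θ) (t := Finset.range K)
    (fun t ht => Finset.mem_range.2 (hK t ht)) (N + 2) (fun k _ => ?_)
  · rwa [Finset.card_range] at this
  set Fk := F.filter (θ · = k) with hFk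
  rcases Fk.eq_empty_or_nonempty with he | hne
  · simp [he]
  set a := Fk.min' hne
  set b := Fk.max' hne
  have ha : a ∈ Fk := Fk.min'_mem hne
  have hb : b ∈ Fk := Fk.max'_mem hne
  have h1 : ((Fk.erase a).erase b).card ≤ N := by
    rcases (Fk.min'_le b hb).eq_or_lt with hab | hab
    · have : (Fk.erase a).erase b = ∅ := by
        refine Finset.eq_empty_of_forall_notMem fun t ht => ?_
        simp only [Finset.mem_erase] at ht
        exact ht.1 (le_antisymm (Fk.le_max' t ht.2.2) (hab ▸ Fk.min'_le t ht.2.2))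
      simp [this]
    · rw [hFk, Finset.mem_filter] at ha hb
      refine hN a ha.1 b hb.1 hab (ha.2.trans hb.2.symm) _ ?_ fun t ht => ?_
      · exact (Finset.erase_subset _ _).trans
          ((Finset.erase_subset _ _).trans (Finset.filter_subset _ _))
      · simp only [Finset.mem_erase] at ht
        exact ⟨lt_of_le_of_ne (Fk.min'_le t ht.2.2) (Ne.symm ht.2.1),
          lt_of_le_of_ne (Fk.le_max' t ht.2.2) ht.1⟩
  have h2 := Finset.pred_card_le_card_erase (s := Fk) (a := a)
  have h3 := Finset.pred_card_le_card_erase (s := Fk.erase a) (a := b)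
  omega

namespace PolyhedralComplex
variable {S : PolyhedralComplex}

/-! ### Stable faces -/

/-- Near every point `p` of a cell there is a point `z` of a face `G` of the cell such that all
points that are not much farther from `z` than `p` lie in cells that contain `G`. -/
theorem exists_stable_face {ε : ℝ} (hε : 0 < ε) :
    ∃ η > 0, ∀ f₀, ∀ p ∈ S.poly f₀, ∃ (G : S.Face) (hG : S.cell G ⊆ S.cell f₀) (z : S.Tangent G),
      z ∈ S.poly G ∧ ‖p - emb hG z‖ < ε ∧
      ∀ (f : S.Face) (hf : S.cell G ⊆ S.cell f), ∀ q ∈ S.poly f,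
        ‖q - emb hf z‖ ≤ ‖p - emb hG z‖ + η → S.cell G ⊆ S.cell (S.cellOf (S.chart f q)) := by
  have key : ∀ n : ℕ, ∃ η > 0, ∀ f₀, ∀ p ∈ S.poly f₀, ∀ (G₀ : S.Face)
      (h₀ : S.cell G₀ ⊆ S.cell f₀), ∀ z₀ ∈ S.poly G₀, S.faceDim G₀ < n → ‖p - emb h₀ z₀‖ < η →
      ∃ (G : S.Face) (hG : S.cell G ⊆ S.cell f₀) (z : S.Tangent G),
      z ∈ S.poly G ∧ ‖p - emb hG z‖ < ε ∧
      ∀ (f : S.Face) (hf : S.cell G ⊆ S.cell f), ∀ q ∈ S.poly f,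
        ‖q - emb hf z‖ ≤ ‖p - emb hG z‖ + η → S.cell G ⊆ S.cell (S.cellOf (S.chart f q)) := by
    intro n
    induction n with
    | zero => exact ⟨1, one_pos, fun _ _ _ _ _ _ _ h => absurd h (Nat.not_lt_zero _)⟩
    | succ n ih =>
      obtain ⟨η₁, hη₁, ih⟩ := ih
      obtain ⟨δ, hδ, hnear⟩ := exists_mem_inter_near (S := S) (half_pos hη₁)
      set η := min (δ / 2) (min (η₁ / 2) ε) with hη
      have hηδ : η ≤ δ / 2 := min_le_left _ _
      have hηη : η ≤ η₁ / 2 := (min_le_right _ _).trans (min_le_left _ _)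
      have hηε : η ≤ ε := (min_le_right _ _).trans (min_le_right _ _)
      refine ⟨η, lt_min (half_pos hδ) (lt_min (half_pos hη₁) hε), ?_⟩
      intro f₀ p hp G₀ h₀ z₀ hz₀ hdim hlt
      by_cases hrob : ∀ (f : S.Face) (hf : S.cell G₀ ⊆ S.cell f), ∀ q ∈ S.poly f,
        ‖q - emb hf z₀‖ ≤ ‖p - emb h₀ z₀‖ + η → S.cell G₀ ⊆ S.cell (S.cellOf (S.chart f q))
      · exact ⟨G₀, h₀, z₀, hz₀, hlt.trans_le hηε, hrob⟩
      push Not at hrob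
      obtain ⟨f, hf, q, hq, hle, hnot⟩ := hrob
      obtain ⟨y, hy, hyG, hyh, hyz⟩ := hnear f G₀ (S.cellOf (S.chart f q)) hf
        (cell_subset_of_mem (chart_mem_cell hq)) z₀ hz₀ q hq (mem_cell_cellOf _) (by linarith)
      have hG' := cell_subset_of_mem hyG
      have hne : S.cellOf (S.chart f y) ≠ G₀ := fun h =>
        hnot (h ▸ cell_subset_of_mem hyh)
      have hmem := mem_cell_cellOf (S.chart f y)
      obtain ⟨G, hG, z, hz, h1, h2⟩ := ih f₀ p hp (S.cellOf (S.chart f y)) (hG'.trans h₀) _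
        (pos_mem hmem) (by have := face_dim_lt hG' hne; omega) (by
          have h1 : emb (hG'.trans h₀) (S.pos _ (S.chart f y)) =
              emb h₀ (S.pos G₀ (S.chart f y)) := by
            rw [emb_pos _ hmem, emb_pos _ hyG]
          have h2 : ‖emb h₀ (S.pos G₀ (S.chart f y)) - emb h₀ z₀‖ = ‖y - emb hf z₀‖ := by
            have h3 := emb_pos hf hyG
            rw [pos_chart hy] at h3
            rw [← dist_eq_norm, ← dist_eq_norm, (emb h₀).dist_map, ← (emb hf).dist_map, h3]
          rw [h1]
          have h3 := norm_sub_le (p - emb h₀ z₀)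
            (emb h₀ (S.pos G₀ (S.chart f y)) - emb h₀ z₀)
          rw [sub_sub_sub_cancel_right, h2] at h3
          linarith)
      exact ⟨G, hG, z, hz, h1, fun k hk q hq hle => h2 k hk q hq (hle.trans (by linarith))⟩
  obtain ⟨η, hη, H⟩ := key (S.dimension + 1)
  refine ⟨η, hη, fun f₀ p hp => H f₀ p hp f₀ Subset.rfl p hp
    (Nat.lt_succ_of_le (faceDim_le_dimension f₀)) ?_⟩
  rwa [emb_self, sub_self, norm_zero]

/-! ### Central projection from a face -/

variable (S) in
/-- A point in the relative interior of `G`. -/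
noncomputable def center (G : S.Face) : S.Tangent G := (interior_poly_nonempty G).choose

theorem center_mem_interior (G : S.Face) : S.center G ∈ interior (S.poly G) :=
  (interior_poly_nonempty G).choose_spec

/-- The component of `p` orthogonal to the face `G` of `f`. -/
noncomputable def normalPart {G f : S.Face} (h : S.cell G ⊆ S.cell f) (p : S.Tangent f) :
    S.Tangent f := perp (emb h).linearIsometry (p - emb h (S.center G))

/-- The central projection of `p` from the face `G` to the sphere of radius `ρ` about the center
of `G` in the orthogonal complement of `G`. -/
noncomputable def radial (ρ : ℝ) {G f : S.Face} (h : S.cell G ⊆ S.cell f) (p : S.Tangent f) :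
    S.Tangent f := emb h (S.center G) + (ρ / ‖normalPart h p‖) • normalPart h p

theorem active_subset_active_center {G f : S.Face} (h : S.cell G ⊆ S.cell f) {p : S.Tangent f}
    (hp : p ∈ S.poly f) (hG : S.cell G ⊆ S.cell (S.cellOf (S.chart f p))) :
    active f p ⊆ active f (emb h (S.center G)) := by
  have hsub := cell_subset_of_mem (chart_mem_cell hp)
  have hpos := emb_pos hsub (mem_cell_cellOf (S.chart f p))
  rw [pos_chart hp] at hpos
  have hc := interior_subset (center_mem_interior G)
  rw [← hpos, active_emb hsub (pos_cellOf_mem_interior _) (emb_mem h hc),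
    ← emb_emb hG hsub h]
  exact mem_image_of_mem _ (emb_mem hG hc)

theorem inner_normal_normalPart {G f : S.Face} (h : S.cell G ⊆ S.cell f) (p : S.Tangent f)
    {i : Fin (S.numIneq f)} (hi : i ∈ active f (emb h (S.center G))) :
    inner ℝ (S.normal f i) (normalPart h p) = inner ℝ (S.normal f i) p - S.bound f i := by
  obtain ⟨y, hy⟩ := exists_eq_add_perp (emb h).linearIsometry (p - emb h (S.center G))
  have h1 : normalPart h p = p - emb h (S.center G) - (emb h).linearIsometry y :=
    eq_sub_of_add_eq' hy.symm
  have h2 : inner ℝ (S.normal f i) (emb h (S.center G)) = S.bound f i := hi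
  rw [h1, inner_sub_right, inner_sub_right, h2,
    (emb_glues h).inner_normal (center_mem_interior G) hi, sub_zero]

theorem normalPart_ne_zero {G f : S.Face} (h : S.cell G ⊆ S.cell f) {p : S.Tangent f}
    (hp : p ∈ S.poly f) (hG : S.cell G ⊆ S.cell (S.cellOf (S.chart f p)))
    (hne : S.cellOf (S.chart f p) ≠ G) : normalPart h p ≠ 0 := by
  intro h0
  refine hne (cell_injective (cell_subset_of_mem ?_) hG)
  rw [chart_mem_cell_iff h hp, ← active_emb h (center_mem_interior G) hp]
  intro i hi
  have := inner_normal_normalPart h p hi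
  rw [h0, inner_zero_right] at this
  exact (sub_eq_zero.1 this.symm)

variable (S) in
theorem exists_radius (G : S.Face) : ∃ ρ > 0,
    (∀ (f : S.Face) (h : S.cell G ⊆ S.cell f), ∀ q ∈ S.poly f,
      ‖q - emb h (S.center G)‖ < 2 * ρ → S.cell G ⊆ S.cell (S.cellOf (S.chart f q))) ∧
    ∀ (f : S.Face) (h : S.cell G ⊆ S.cell f), ∀ p ∈ S.poly f,
      S.cell G ⊆ S.cell (S.cellOf (S.chart f p)) → S.cellOf (S.chart f p) ≠ G →
      radial ρ h p ∈ S.poly f ∧ S.cellOf (S.chart f (radial ρ h p)) = S.cellOf (S.chart f p) := by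
  obtain ⟨ε, hε, hstar⟩ := exists_star_radius (S.chart G (S.center G))
  have hc := center_mem_interior G
  have hcG := chart_mem_cell (interior_subset hc)
  have hev : ∀ᶠ ρ in 𝓝[>] (0 : ℝ), ∀ (f : S.Face) (i : Fin (S.numIneq f))
      (h : S.cell G ⊆ S.cell f), i ∉ active f (emb h (S.center G)) →
      ρ * ‖S.normal f i‖ < S.bound f i - inner ℝ (S.normal f i) (emb h (S.center G)) := by
    simp only [eventually_all]
    intro f i h hi
    have h1 : Tendsto (fun ρ : ℝ => ρ * ‖S.normal f i‖) (𝓝 0) (𝓝 0) :=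
      Continuous.tendsto' (by fun_prop) 0 0 (zero_mul _)
    refine (h1.eventually (gt_mem_nhds ?_)).filter_mono nhdsWithin_le_nhds
    exact sub_pos.2 (lt_of_le_of_ne (mem_poly.1 (emb_mem h (interior_subset hc)) i) hi)
  obtain ⟨ρ, ⟨hρ, hρε⟩, hρ0⟩ := ((hev.and ((gt_mem_nhds (half_pos hε)).filter_mono
    nhdsWithin_le_nhds)).and self_mem_nhdsWithin).exists
  have hρ0 : 0 < ρ := hρ0
  refine ⟨ρ, hρ0, fun f h q hq hlt => ?_, fun f h p hp hG hne => ?_⟩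
  · have h1 := hstar f (h hcG) q hq (by
      rw [← emb_pos h hcG, pos_chart (interior_subset hc)]; linarith)
    have := cell_subset_of_mem h1
    rwa [cellOf_chart hc] at this
  · have hw := normalPart_ne_zero h hp hG hne
    have hw0 := norm_pos_iff.2 hw
    set w := normalPart h p with hwdef
    have hsub := active_subset_active_center h hp hG
    have hin : ∀ i ∈ active f (emb h (S.center G)), inner ℝ (S.normal f i) (radial ρ h p) -
        S.bound f i = (ρ / ‖w‖) * (inner ℝ (S.normal f i) p - S.bound f i) := by
      intro i hi
      have h2 : inner ℝ (S.normal f i) (emb h (S.center G)) = S.bound f i := hi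
      rw [radial, inner_add_right, inner_smul_right, inner_normal_normalPart h p hi, h2]
      ring
    have hout : ∀ i ∉ active f (emb h (S.center G)),
        inner ℝ (S.normal f i) (radial ρ h p) < S.bound f i := by
      intro i hi
      have h1 := hρ f i h hi
      have h2 : inner ℝ (S.normal f i) ((ρ / ‖w‖) • w) ≤ ρ * ‖S.normal f i‖ := by
        refine (real_inner_le_norm _ _).trans_eq ?_
        rw [norm_smul, Real.norm_eq_abs, abs_of_pos (by positivity), div_mul_cancel₀ _ hw0.ne',
          mul_comm]
      rw [radial, inner_add_right]
      linarith
    have hmem : radial ρ h p ∈ S.poly f := by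
      refine mem_poly.2 fun i => ?_
      by_cases hi : i ∈ active f (emb h (S.center G))
      · have h1 := hin i hi
        have h2 : (ρ / ‖w‖) * (inner ℝ (S.normal f i) p - S.bound f i) ≤ 0 :=
          mul_nonpos_of_nonneg_of_nonpos (by positivity) (sub_nonpos.2 (mem_poly.1 hp i))
        linarith
      · exact (hout i hi).le
    refine ⟨hmem, cellOf_eq_of_active hmem hp (Set.ext fun i => ?_)⟩
    by_cases hi : i ∈ active f (emb h (S.center G))
    · have h1 := hin i hi
      simp only [active, mem_ofPred_eq]
      rw [← sub_eq_zero, h1, mul_eq_zero, sub_eq_zero, or_iff_right (by positivity)]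
    · exact ⟨fun hr => absurd hr (hout i hi).ne, fun hr => absurd (hsub hr) hi⟩

theorem norm_radial_sub_center {ρ : ℝ} (hρ : 0 < ρ) {G f : S.Face} (h : S.cell G ⊆ S.cell f)
    {p : S.Tangent f} (hw : normalPart h p ≠ 0) : ‖radial ρ h p - emb h (S.center G)‖ = ρ := by
  rw [radial, add_sub_cancel_left, norm_smul, Real.norm_eq_abs, abs_of_nonneg (by positivity),
    div_mul_cancel₀ _ (norm_ne_zero_iff.2 hw)]

theorem le_norm_radial_sub {ρ : ℝ} (hρ : 0 < ρ) {G f : S.Face} (h : S.cell G ⊆ S.cell f)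
    {p : S.Tangent f} (hw : normalPart h p ≠ 0) (z : S.Tangent G) :
    ρ ≤ ‖radial ρ h p - emb h z‖ := by
  have h1 := norm_sub_sq_of_inner hw hρ.le ((emb h).linearIsometry (z - S.center G))
  have h0 : inner ℝ (normalPart h p) ((emb h).linearIsometry (z - S.center G)) = 0 :=
    inner_perp _ _ _
  rw [h0] at h1
  have h2 : radial ρ h p - emb h z = (ρ / ‖normalPart h p‖) • normalPart h p -
      (emb h).linearIsometry (z - S.center G) := by
    rw [radial, affineIsometry_apply (emb h) (S.center G) z]; abel
  rw [h2]
  refine abs_le_of_sq_le_sq' ?_ (norm_nonneg _) |>.2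
  rw [h1]
  nlinarith [sq_nonneg ‖(emb h).linearIsometry (z - S.center G)‖]

theorem emb_linear_emb {g k f : S.Face} (h : S.cell g ⊆ S.cell k) (h' : S.cell k ⊆ S.cell f)
    (h'' : S.cell g ⊆ S.cell f) (u : S.Tangent g) :
    (emb h'').linearIsometry u = (emb h').linearIsometry ((emb h).linearIsometry u) := by
  have h1 := emb_emb h h' h'' (0 + u)
  rw [affineIsometry_apply (emb h'') 0, affineIsometry_apply (emb h) 0,
    affineIsometry_apply (emb h') (emb h 0), emb_emb h h' h'' 0] at h1
  simp only [add_sub_cancel_left] at h1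
  exact (add_left_cancel h1).symm

theorem norm_sub_center_sub {G k : S.Face} (h : S.cell G ⊆ S.cell k) {p : S.Tangent k} {y : S.Tangent G}
    (u : S.Tangent G) : ‖p - emb h y - (emb h).linearIsometry u‖ = ‖p - emb h (y + u)‖ := by
  rw [affineIsometry_apply (emb h) y (y + u), add_sub_cancel_left]
  congr 1; abel

/-- Equal distances from the points of the affine span of `G'` imply equal distances after the
central projections from a face `G` of `G'`. -/
theorem norm_radial_sub_eq {ρ : ℝ} (hρ : 0 < ρ) {G G' f f' : S.Face} (hGG : S.cell G ⊆ S.cell G')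
    (hf : S.cell G' ⊆ S.cell f) (hf' : S.cell G' ⊆ S.cell f') (hGf : S.cell G ⊆ S.cell f)
    (hGf' : S.cell G ⊆ S.cell f') {p : S.Tangent f} {p' : S.Tangent f'}
    (h : ∀ z, ‖p - emb hf z‖ = ‖p' - emb hf' z‖) (hw : normalPart hGf p ≠ 0) (z : S.Tangent G') :
    ‖radial ρ hGf p - emb hf z‖ = ‖radial ρ hGf' p' - emb hf' z‖ := by
  set c := emb hGG (S.center G) with hc
  have hcf : emb hGf (S.center G) = emb hf c := (emb_emb _ _ _ _).symm
  have hcf' : emb hGf' (S.center G) = emb hf' c := (emb_emb _ _ _ _).symm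
  have hV : ∀ v, ‖p - emb hGf (S.center G) - (emb hf).linearIsometry v‖ =
      ‖p' - emb hGf' (S.center G) - (emb hf').linearIsometry v‖ := by
    intro v
    rw [hcf, hcf', norm_sub_center_sub, norm_sub_center_sub, h]
  have hU : ∀ u, ‖p - emb hGf (S.center G) - (emb hGf).linearIsometry u‖ =
      ‖p' - emb hGf' (S.center G) - (emb hGf').linearIsometry u‖ := by
    intro u
    rw [emb_linear_emb hGG hf hGf, emb_linear_emb hGG hf' hGf', hV]
  have hnorm : ‖normalPart hGf p‖ = ‖normalPart hGf' p'‖ := norm_perp_eq hU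
  have hw' : normalPart hGf' p' ≠ 0 := by
    rw [← norm_ne_zero_iff, ← hnorm]; exact norm_ne_zero_iff.2 hw
  have hinner := inner_perp_eq (emb_linear_emb hGG hf hGf) (emb_linear_emb hGG hf' hGf') hV (z - c)
  have hrad : ∀ {k : S.Face} (hk : S.cell G' ⊆ S.cell k) (hGk : S.cell G ⊆ S.cell k)
      (q : S.Tangent k), radial ρ hGk q - emb hk z = (ρ / ‖normalPart hGk q‖) • normalPart hGk q -
        (emb hk).linearIsometry (z - c) := by
    intro k hk hGk q
    rw [radial, affineIsometry_apply (emb hk) c z, ← emb_emb hGG hk hGk]; abel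
  rw [hrad, hrad, ← pow_left_inj₀ (norm_nonneg _) (norm_nonneg _) two_ne_zero,
    norm_sub_sq_of_inner hw hρ.le, norm_sub_sq_of_inner hw' hρ.le, hnorm, LinearIsometry.norm_map,
    LinearIsometry.norm_map]
  congr 3

theorem norm_radial_sub_radial {ρ : ℝ} (hρ : 0 < ρ) {G f : S.Face} (h : S.cell G ⊆ S.cell f)
    (p q : S.Tangent f) : ‖radial ρ h p - radial ρ h q‖ =
      ρ * ‖(1 / ‖normalPart h p‖) • normalPart h p - (1 / ‖normalPart h q‖) • normalPart h q‖ := by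
  rw [radial, radial, add_sub_add_left_eq_sub, ← abs_of_pos hρ, ← Real.norm_eq_abs, ← norm_smul,
    smul_sub, smul_smul, smul_smul, mul_one_div, mul_one_div, Real.norm_eq_abs, abs_of_pos hρ]

/-! ### Bounding the number of cell changes -/

theorem star_bound (G : S.Face) : ∃ N : ℕ, ∀ (γ : ℝ → S.Carrier) (a b : ℝ),
    (∀ t ∈ Ioo a b, IsStraightAt γ t ∧ S.cell G ⊆ S.cell (S.cellOf (γ t))) →
    ∀ F : Finset ℝ, (∀ t ∈ F, t ∈ Ioo a b ∧ IsBreak γ t) → F.card ≤ N := by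
  induction hn : S.dimension - S.faceDim G using Nat.strong_induction_on generalizing G with
  | _ n ih =>
  subst hn
  have ih' : ∀ G' : S.Face, ∃ N : ℕ, S.faceDim G < S.faceDim G' →
      ∀ (γ : ℝ → S.Carrier) (a b : ℝ),
      (∀ t ∈ Ioo a b, IsStraightAt γ t ∧ S.cell G' ⊆ S.cell (S.cellOf (γ t))) →
      ∀ F : Finset ℝ, (∀ t ∈ F, t ∈ Ioo a b ∧ IsBreak γ t) → F.card ≤ N := by
    intro G'
    by_cases hlt : S.faceDim G < S.faceDim G'
    · obtain ⟨N, hN⟩ := ih _ (by have := faceDim_le_dimension G'; omega) G' rfl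
      exact ⟨N, fun _ => hN⟩
    · exact ⟨0, fun h => absurd h hlt⟩
  choose N hN using ih'
  obtain ⟨ρ, hρ, hstar, hradial⟩ := S.exists_radius G
  obtain ⟨η, hη, hstable⟩ := exists_stable_face (S := S) hρ
  obtain ⟨K, hK⟩ := exists_angular_partition (η := η / ρ) (by positivity)
  refine ⟨max 1 ((Finset.univ.sup N + 2) * K), fun γ a b hγ F hF => ?_⟩
  by_cases hzero : ∃ t₀ ∈ Ioo a b, S.cellOf (γ t₀) = G
  · obtain ⟨t₀, ht₀, h₀⟩ := hzero
    refine le_max_of_le_left (Finset.card_le_one.2 fun s hs t ht => ?_)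
    rw [eq_of_isBreak_of_cellOf_eq hγ ht₀ h₀ (hF s hs).1 (hF s hs).2,
      eq_of_isBreak_of_cellOf_eq hγ ht₀ h₀ (hF t ht).1 (hF t ht).2]
  push Not at hzero
  refine le_max_of_le_right ?_
  rcases F.eq_empty_or_nonempty with rfl | ⟨t₁, ht₁⟩
  · simp
  obtain ⟨f₁, e₁, -, -, hr₁, -⟩ := (hγ t₁ (hF t₁ ht₁).1).1
  have hG₁ := (hγ t₁ (hF t₁ ht₁).1).2.trans hr₁.cell_subset
  -- the line that represents the path, seen from a base time
  have hline : ∀ {t₀ : ℝ}, t₀ ∈ Ioo a b → ∀ {f : S.Face} {e : S.Tangent f},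
      IsRay (γ t₀) (fun u => γ (t₀ + u)) f e → ∀ (hf : S.cell G ⊆ S.cell f) {t : ℝ},
      t ∈ Ioo a b → ∀ {k : S.Face} (hk : S.cell G ⊆ S.cell k), γ t ∈ S.cell k → ∀ z,
      ‖S.pos k (γ t) - emb hk z‖ = ‖S.pos f (γ t₀) + (t - t₀) • e - emb hf z‖ :=
    fun ht₀ _ _ hr hf _ ht _ hk htk z =>
      norm_pos_sub_eq_line z hγ ⟨ht₀.1.le, ht₀.2⟩ hr hf ht hk htk
  let w : ℝ → S.Tangent f₁ := fun t => normalPart hG₁ (S.pos f₁ (γ t₁) + (t - t₁) • e₁)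
  have hnorm : ∀ {t : ℝ}, t ∈ Ioo a b → ∀ {k : S.Face} (hk : S.cell G ⊆ S.cell k),
      γ t ∈ S.cell k → normalPart hk (S.pos k (γ t)) ≠ 0 ∧
      ‖normalPart hk (S.pos k (γ t))‖ = ‖w t‖ := by
    intro t ht k hk htk
    constructor
    · refine normalPart_ne_zero hk (pos_mem htk) ?_ ?_ <;> rw [chart_pos htk]
      exacts [(hγ t ht).2, hzero t ht]
    · refine norm_perp_eq fun u => ?_
      rw [norm_sub_center_sub, norm_sub_center_sub]
      exact hline (hF t₁ ht₁).1 hr₁ hG₁ ht hk htk _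
  have hw0 : ∀ t ∈ Ioo a b, w t ≠ 0 := fun t ht => by
    obtain ⟨h1, h2⟩ := hnorm ht (hγ t ht).2 (mem_cell_cellOf _)
    rw [← norm_ne_zero_iff, ← h2]
    exact norm_ne_zero_iff.2 h1
  set A := normalPart hG₁ (S.pos f₁ (γ t₁) - t₁ • e₁)
  set B := perp (emb hG₁).linearIsometry e₁
  have hwAB : ∀ t, w t = A + t • B := by
    intro t
    simp only [w, A, B, normalPart]
    rw [← perp_add_smul]
    congr 1; module
  obtain ⟨θ, hθK, hθmono, hθ⟩ := hK A B
  simp only [← hwAB] at hθmono hθ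
  refine card_le_of_partition (fun t _ => hθK t) fun a' ha' b' hb' hab hθab F' hF' hF'ab => ?_
  have ha := (hF a' ha').1
  have hb := (hF b' hb').1
  have hsub : Ioo a' b' ⊆ Ioo a b := fun t ht => ⟨ha.1.trans ht.1, ht.2.trans hb.2⟩
  have hθc : ∀ t ∈ Ioo a' b', θ t = θ a' := fun t ht => le_antisymm
    ((hθmono t b' ht.2.le (hw0 t (hsub ht)) (hw0 b' hb)).trans_eq hθab.symm)
    (hθmono a' t ht.1.le (hw0 a' ha) (hw0 t (hsub ht)))
  obtain ⟨f, e, -, -, hr, -⟩ := (hγ a' ha).1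
  have hGf := (hγ a' ha).2.trans hr.cell_subset
  set p := S.pos f (γ a')
  have hp : p ∈ S.poly f := pos_mem hr.mem
  have hpw := (hnorm ha hGf hr.mem).1
  have hpr := (hradial f hGf p hp (by rw [chart_pos hr.mem]; exact (hγ a' ha).2)
    (by rw [chart_pos hr.mem]; exact hzero a' ha)).1
  obtain ⟨G', hG', z, hz, hzρ, hrob⟩ := hstable f _ hpr
  have hGG : S.cell G ⊆ S.cell G' := by
    have h1 := hstar f hGf _ (emb_mem hG' hz) (by
      have h1 := norm_sub_le (radial ρ hGf p - emb hGf (S.center G))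
        (radial ρ hGf p - emb hG' z)
      rw [sub_sub_sub_cancel_left, norm_radial_sub_center hρ hGf hpw] at h1
      linarith)
    rw [chart_emb hG' hz] at h1
    exact h1.trans (cell_subset_of_mem (chart_mem_cell hz))
  have hne : G ≠ G' := by
    rintro rfl
    exact absurd hzρ (not_lt.2 (le_norm_radial_sub hρ hG' hpw z))
  have hstay : ∀ t ∈ Ioo a' b', S.cell G' ⊆ S.cell (S.cellOf (γ t)) := by
    refine star_extend (fun t ht => (hγ t (hsub ht)).1) hr hG' fun T hT k hk hTk hdist => ?_
    have hTab := hsub hT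
    have hGk := hGG.trans hk
    obtain ⟨hTw, hTn⟩ := hnorm hTab hGk hTk
    have hrT := hradial k hGk (S.pos k (γ T)) (pos_mem hTk)
      (by rw [chart_pos hTk]; exact (hγ T hTab).2) (by rw [chart_pos hTk]; exact hzero T hTab)
    rw [chart_pos hTk] at hrT
    rw [← hrT.2]
    refine hrob k hk _ hrT.1 ?_
    set q := p + (T - a') • e with hq
    have hq0 : normalPart hGf q ≠ 0 := by
      have h1 : ‖normalPart hGk (S.pos k (γ T))‖ = ‖normalPart hGf q‖ := norm_perp_eq fun u => by
        rw [norm_sub_center_sub, norm_sub_center_sub]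
        exact hline ha hr hGf hTab hGk hTk _
      rw [← norm_ne_zero_iff, ← h1]
      exact norm_ne_zero_iff.2 hTw
    rw [norm_radial_sub_eq hρ hGG hk hG' hGk hGf hdist hTw z]
    have hclose : ‖radial ρ hGf q - radial ρ hGf p‖ ≤ η := by
      have hinner : inner ℝ (normalPart hGf q) (normalPart hGf p) = inner ℝ (w T) (w a') := by
        refine inner_perp_perp_eq (fun u => ?_) (fun u => ?_) ?_
        · rw [norm_sub_center_sub, norm_sub_center_sub, ← hline ha hr hGf hTab hGk hTk,
            hline (hF t₁ ht₁).1 hr₁ hG₁ hTab hGk hTk]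
        · rw [norm_sub_center_sub, norm_sub_center_sub]
          exact hline (hF t₁ ht₁).1 hr₁ hG₁ ha hGf hr.mem _
        · rw [sub_sub_sub_cancel_right, sub_sub_sub_cancel_right, hq, add_sub_cancel_left,
            add_sub_add_left_eq_sub, ← sub_smul, norm_smul, norm_smul, hr.norm_eq, hr₁.norm_eq,
            sub_sub_sub_cancel_right]
      have hnq : ‖normalPart hGf q‖ = ‖w T‖ := by
        rw [← hTn]
        refine norm_perp_eq fun u => ?_
        rw [norm_sub_center_sub, norm_sub_center_sub]
        exact (hline ha hr hGf hTab hGk hTk _).symm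
      have hnp : ‖normalPart hGf p‖ = ‖w a'‖ := (hnorm ha hGf hr.mem).2
      have h1 := hθ T a' (hw0 T hTab) (hw0 a' ha) (hθc T hT)
      have h2 : ‖(1 / ‖normalPart hGf q‖) • normalPart hGf q -
          (1 / ‖normalPart hGf p‖) • normalPart hGf p‖ =
          ‖(1 / ‖w T‖) • w T - (1 / ‖w a'‖) • w a'‖ := by
        rw [← pow_left_inj₀ (norm_nonneg _) (norm_nonneg _) two_ne_zero,
          norm_smul_sub_smul_sq hq0 hpw, norm_smul_sub_smul_sq (hw0 T hTab) (hw0 a' ha),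
          hinner, hnq, hnp]
      rw [norm_radial_sub_radial hρ, h2]
      calc _ ≤ ρ * (η / ρ) := by gcongr
        _ = η := by field_simp
    have h3 := norm_add_le (radial ρ hGf q - radial ρ hGf p) (radial ρ hGf p - emb hG' z)
    rw [sub_add_sub_cancel] at h3
    linarith
  refine (hN G' (face_dim_lt hGG hne) γ a' b' (fun t ht => ⟨(hγ t (hsub ht)).1, hstay t ht⟩) F'
    fun t ht => ⟨hF'ab t ht, (hF t (hF' ht)).2⟩).trans ?_
  exact Finset.le_sup (f := N) (Finset.mem_univ G')

variable (S) in
/-- The number of times at which a geodesic of bounded length changes its open cell is bounded. -/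
theorem exists_break_bound (R : ℝ) : ∃ N : ℕ, ∀ (γ : ℝ → S.Carrier) (r : ℝ), r ≤ R →
    IsGeodesicOn γ r → ∀ F : Finset ℝ, (∀ t ∈ F, t ∈ Ioo 0 r ∧ IsBreak γ t) → F.card ≤ N := by
  choose N hN using star_bound (S := S)
  obtain ⟨η, hη, hstable⟩ := exists_stable_face (S := S) one_pos
  refine ⟨(Finset.univ.sup N + 2) * (⌊R / η⌋₊ + 1), fun γ r hrR hγ F hF => ?_⟩
  refine card_le_of_partition (θ := fun t => ⌊t / η⌋₊) (fun t ht => ?_)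
    fun a ha b hb hab hθ F' hF' hF'ab => ?_
  · refine Nat.lt_succ_of_le (Nat.floor_mono ?_)
    gcongr
    exact (hF t ht).1.2.le.trans hrR
  have ha0 := (hF a ha).1
  have hb0 := (hF b hb).1
  have hbη : b - a ≤ η := by
    have h1 := Nat.floor_le (div_nonneg ha0.1.le hη.le)
    have h2 := Nat.lt_floor_add_one (b / η)
    rw [← hθ] at h2
    have h3 : (b - a) / η ≤ 1 := by rw [sub_div]; linarith
    rwa [div_le_one hη] at h3
  have hsub : Ioo a b ⊆ Ioo 0 r := fun t ht => ⟨ha0.1.trans ht.1, ht.2.trans hb0.2⟩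
  obtain ⟨f, e, hr⟩ := hγ.exists_right_ray ⟨ha0.1.le, ha0.2⟩
  obtain ⟨G, hG, z, hz, -, hrob⟩ := hstable f _ (pos_mem hr.mem)
  have hstay := star_extend (fun t ht => hγ.isStraightAt (hsub ht)) hr hG
    (b := b) fun T hT k hk hTk hdist => by
      have h1 := hrob k hk _ (pos_mem hTk) (by
        rw [hdist z]
        have h1 := norm_add_le (S.pos f (γ a) - emb hG z) ((T - a) • e)
        rw [norm_smul, hr.norm_eq, mul_one, Real.norm_eq_abs, abs_of_pos (sub_pos.2 hT.1),
          sub_add_eq_add_sub] at h1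
        linarith [hT.2])
      rwa [chart_pos hTk] at h1
  refine (hN G γ a b (fun t ht => ⟨hγ.isStraightAt (hsub ht), hstay t ht⟩) F'
    fun t ht => ⟨hF'ab t ht, (hF t (hF' ht)).2⟩).trans ?_
  exact Finset.le_sup (f := N) (Finset.mem_univ G)

end PolyhedralComplex

namespace PolyhedralComplex
variable {S : PolyhedralComplex}

/-! ### Facet sequences -/

theorem mem_facetInteriors {x : S.Carrier} : x ∈ S.facetInteriors ↔ S.IsFacet (S.cellOf x) := by
  simp only [facetInteriors, mem_iUnion, exists_prop]
  constructor
  · rintro ⟨f, hf, hx⟩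
    rwa [cellOf_eq hx]
  · exact fun h => ⟨_, h, mem_openCell_cellOf x⟩

theorem IsGeodesicOn.exists_isBreak {γ : ℝ → S.Carrier} {r a b u : ℝ} (hγ : IsGeodesicOn γ r)
    (ha : 0 ≤ a) (hb : b ≤ r) (hu : u ∈ Ioo a b) (haF : γ a ∈ S.facetInteriors)
    (huF : γ u ∉ S.facetInteriors) : ∃ t ∈ Ioo a b, IsBreak γ t := by
  by_contra! hno
  obtain ⟨f, e, hr⟩ := hγ.exists_right_ray ⟨ha, (hu.1.trans hu.2).trans_le hb⟩
  rw [mem_facetInteriors] at haF huF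
  have hf : f = S.cellOf (γ a) := haF f hr.cell_subset
  obtain ⟨d, hd, hd'⟩ := (hr.eventually_cellOf.and
    (Ioo_mem_nhdsGT (sub_pos.2 (hu.1.trans hu.2)))).exists
  have hconst : S.cellOf (γ u) = S.cellOf (γ (a + d)) :=
    eq_of_eventually_eq_on_Ioo (F := fun t => S.cellOf (γ t))
      (fun t ht => not_not.1 (hno t ht)) hu ⟨by linarith [hd'.1], by linarith [hd'.2]⟩
  rw [hconst, hd, hf] at huF
  exact huF haF

/-- The times in `A` lie in pairwise different traversals of facet interiors. -/
def Separated (γ : ℝ → S.Carrier) (r : ℝ) (A : Finset ℝ) : Prop :=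
  (∀ a ∈ A, a ∈ Icc 0 r ∧ γ a ∈ S.facetInteriors) ∧
    ∀ a ∈ A, ∀ b ∈ A, a < b → ∃ u ∈ Ioo a b, γ u ∉ S.facetInteriors

theorem Separated.exists_breaks {γ : ℝ → S.Carrier} {r : ℝ} (hγ : IsGeodesicOn γ r)
    {A : Finset ℝ} (hA : Separated γ r A) : ∃ F : Finset ℝ,
      (∀ t ∈ F, t ∈ Ioo 0 r ∧ IsBreak γ t) ∧ (∀ t ∈ F, ∃ a ∈ A, t < a) ∧
      A.card ≤ F.card + 1 := by
  classical
  induction A using Finset.induction_on_max with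
  | empty => exact ⟨∅, by simp⟩
  | insert a A ha ih =>
    obtain ⟨F, hF, hFA, hcard⟩ := ih ⟨fun x hx => hA.1 x (Finset.mem_insert_of_mem hx),
      fun x hx y hy => hA.2 x (Finset.mem_insert_of_mem hx) y (Finset.mem_insert_of_mem hy)⟩
    have haA : a ∉ A := fun h => lt_irrefl a (ha a h)
    rcases A.eq_empty_or_nonempty with rfl | hne
    · exact ⟨∅, by simp⟩
    set m := A.max' hne
    have hm : m ∈ A := A.max'_mem hne
    have hm' := hA.1 m (Finset.mem_insert_of_mem hm)
    have ha' := hA.1 a (Finset.mem_insert_self _ _)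
    obtain ⟨u, hu, huF⟩ := hA.2 m (Finset.mem_insert_of_mem hm) a (Finset.mem_insert_self _ _)
      (ha m hm)
    obtain ⟨t, ht, htb⟩ := hγ.exists_isBreak hm'.1.1 ha'.1.2 hu hm'.2 huF
    have htF : t ∉ F := fun h => by
      obtain ⟨x, hx, htx⟩ := hFA t h
      exact absurd (htx.trans_le (A.le_max' x hx)) (not_lt.2 ht.1.le)
    refine ⟨insert t F, fun x hx => ?_, fun x hx => ?_, ?_⟩
    · rcases Finset.mem_insert.1 hx with rfl | hx
      · exact ⟨⟨hm'.1.1.trans_lt ht.1, ht.2.trans_le ha'.1.2⟩, htb⟩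
      · exact hF x hx
    · rcases Finset.mem_insert.1 hx with rfl | hx
      · exact ⟨a, Finset.mem_insert_self _ _, ht.2⟩
      · obtain ⟨y, hy, hxy⟩ := hFA x hx
        exact ⟨y, Finset.mem_insert_of_mem hy, hxy⟩
    · rw [Finset.card_insert_of_notMem haA, Finset.card_insert_of_notMem htF]
      omega

variable (S) in
theorem exists_separated_bound (R : ℝ) : ∃ N : ℕ, 0 < N ∧ ∀ (γ : ℝ → S.Carrier) (r : ℝ), r ≤ R →
    IsGeodesicOn γ r → ∀ A : Finset ℝ, Separated γ r A → A.card ≤ N := by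
  obtain ⟨N, hN⟩ := S.exists_break_bound R
  refine ⟨N + 1, Nat.succ_pos N, fun γ r hr hγ A hA => ?_⟩
  obtain ⟨F, hF, -, hcard⟩ := hA.exists_breaks hγ
  have := hN γ r hr hγ F hF
  omega

theorem exists_isFacetSequence {γ : ℝ → S.Carrier} {r : ℝ} {N : ℕ}
    (hN : ∀ A : Finset ℝ, Separated γ r A → A.card ≤ N) : ∃ L, S.IsFacetSequence γ r L := by
  classical
  let P : ℕ → Prop := fun n => ∃ A : Finset ℝ, Separated γ r A ∧ A.card = n
  have h0 : P 0 := ⟨∅, ⟨by simp, by simp⟩, rfl⟩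
  obtain ⟨A, hA, hAcard⟩ : P (Nat.findGreatest P N) := Nat.findGreatest_spec (Nat.zero_le N) h0
  have hmax : ∀ A', Separated γ r A' → A'.card ≤ A.card := fun A' hA' => by
    rw [hAcard]
    exact Nat.le_findGreatest (hN A' hA') ⟨A', hA', rfl⟩
  let e := A.orderEmbOfFin rfl
  have he : ∀ i, e i ∈ A := fun i => A.orderEmbOfFin_mem rfl i
  let L : List S.Face := List.ofFn fun i => S.cellOf (γ (e i))
  have hL : L.length = A.card := List.length_ofFn
  refine ⟨L, fun i => e (i.cast hL), fun i j hij => e.strictMono (by simpa using hij),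
    fun i => ?_, fun t ht htF => ?_⟩
  · obtain ⟨h1, h2⟩ := hA.1 _ (he (i.cast hL))
    have h3 : L.get i = S.cellOf (γ (e (i.cast hL))) := by simp [L, e]; rfl
    rw [h3]
    exact ⟨h1, mem_facetInteriors.1 h2, mem_openCell_cellOf _⟩
  · refine existsUnique_of_exists_of_unique ?_ ?_
    · by_contra! hcon
      have hcon' : ∀ a ∈ A, ∃ u ∈ uIcc t a, γ u ∉ S.facetInteriors := by
        intro a ha
        obtain ⟨i, hi⟩ : ∃ i, e i = a := by
          have : a ∈ Set.range e := by rw [Finset.range_orderEmbOfFin]; exact ha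
          exact this
        have := hcon (i.cast hL.symm)
        rwa [Fin.cast_cast, Fin.cast_eq_self, hi] at this
      have htA : t ∉ A := fun h => by
        obtain ⟨u, hu, huF⟩ := hcon' t h
        rw [uIcc_self, mem_singleton_iff] at hu
        exact huF (hu ▸ htF)
      have hne : ∀ {u a}, a ∈ A → γ u ∉ S.facetInteriors → u ≠ t ∧ u ≠ a := fun ha hu =>
        ⟨fun h => hu (h ▸ htF), fun h => hu (h ▸ (hA.1 _ ha).2)⟩
      have hsep : Separated γ r (insert t A) := by
        refine ⟨fun a ha => ?_, fun a ha b hb hab => ?_⟩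
        · rcases Finset.mem_insert.1 ha with rfl | ha
          exacts [⟨ht, htF⟩, hA.1 a ha]
        · rcases Finset.mem_insert.1 ha with rfl | ha₁ <;>
            rcases Finset.mem_insert.1 hb with rfl | hb₁
          · exact absurd hab (lt_irrefl _)
          · obtain ⟨u, hu, huF⟩ := hcon' b hb₁
            rw [uIcc_of_le hab.le] at hu
            obtain ⟨h1, h2⟩ := hne hb₁ huF
            exact ⟨u, ⟨lt_of_le_of_ne hu.1 h1.symm, lt_of_le_of_ne hu.2 h2⟩, huF⟩
          · obtain ⟨u, hu, huF⟩ := hcon' a ha₁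
            rw [uIcc_of_ge hab.le] at hu
            obtain ⟨h1, h2⟩ := hne ha₁ huF
            exact ⟨u, ⟨lt_of_le_of_ne hu.1 h2.symm, lt_of_le_of_ne hu.2 h1⟩, huF⟩
          · exact hA.2 a ha₁ b hb₁ hab
      have := hmax _ hsep
      rw [Finset.card_insert_of_notMem htA] at this
      omega
    · intro i j hi hj
      have key : ∀ {i j : Fin L.length}, (∀ u ∈ uIcc t (e (i.cast hL)), γ u ∈ S.facetInteriors) →
          (∀ u ∈ uIcc t (e (j.cast hL)), γ u ∈ S.facetInteriors) → ¬ i < j := by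
        intro i j hi hj hij
        have hlt : e (i.cast hL) < e (j.cast hL) := e.strictMono (by simpa using hij)
        obtain ⟨u, hu, huF⟩ := hA.2 _ (he _) _ (he _) hlt
        have : u ∈ uIcc (e (i.cast hL)) (e (j.cast hL)) := by
          rw [uIcc_of_le hlt.le]; exact ⟨hu.1.le, hu.2.le⟩
        rcases uIcc_subset_uIcc_union_uIcc (b := t) this with h | h
        · exact huF (hi u (uIcc_comm t _ ▸ h))
        · exact huF (hj u h)
      exact le_antisymm (not_lt.1 (key hj hi)) (not_lt.1 (key hi hj))

theorem IsFacetSequence.length_le {γ : ℝ → S.Carrier} {r : ℝ} {N : ℕ}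
    (hN : ∀ A : Finset ℝ, Separated γ r A → A.card ≤ N) {L : List S.Face}
    (hL : S.IsFacetSequence γ r L) : L.length ≤ N := by
  classical
  obtain ⟨τ, hτ, hmem, huniq⟩ := hL
  have hF : ∀ i, γ (τ i) ∈ S.facetInteriors := fun i => by
    rw [mem_facetInteriors, cellOf_eq (hmem i).2.2]
    exact (hmem i).2.1
  have hsep : Separated γ r (Finset.univ.image τ) := by
    constructor
    · intro a ha
      obtain ⟨i, -, rfl⟩ := Finset.mem_image.1 ha
      exact ⟨(hmem i).1, hF i⟩
    · intro a ha b hb hab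
      obtain ⟨i, -, rfl⟩ := Finset.mem_image.1 ha
      obtain ⟨j, -, rfl⟩ := Finset.mem_image.1 hb
      by_contra! hno
      have hall : ∀ u ∈ uIcc (τ i) (τ j), γ u ∈ S.facetInteriors := by
        intro u hu
        rw [uIcc_of_le hab.le] at hu
        rcases hu.1.eq_or_lt with h | h
        · exact h ▸ hF i
        · rcases hu.2.eq_or_lt with h' | h'
          · exact h' ▸ hF j
          · exact hno u ⟨h, h'⟩
      have := (huniq (τ i) (hmem i).1 (hF i)).unique
        (y₁ := i) (y₂ := j) (by simpa using hF i) hall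
      exact hab.ne (congrArg τ this)
  have := hN _ hsep
  rwa [Finset.card_image_of_injective _ hτ.injective, Finset.card_univ, Fintype.card_fin] at this

end PolyhedralComplex

namespace PolyhedralComplex
variable {S : PolyhedralComplex}

/-! ### Images of the source point under compositions of folding maps -/

variable (S) in
/-- The images, in the tangent hyperplane of a facet, of the point `v` under the compositions of
`k` folding maps. -/
def foldImages (v : S.Carrier) : ℕ → (F : S.Face) → Set (S.Tangent F)
  | 0, F => {p | p ∈ S.poly F ∧ S.chart F p = v}
  | k + 1, G => {y | ∃ (F R : S.Face) (Φ : S.Tangent F ≃ᵃⁱ[ℝ] S.Tangent G),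
      S.IsFoldingMap F G R Φ ∧ ∃ p ∈ foldImages v k F, Φ p = y}

/-- The points with given distances from the points of a hyperplane form a finite set. -/
theorem finite_setOf_norm_sub_eq {R F : S.Face} (h : S.cell R ⊆ S.cell F)
    (hdim : S.faceDim F = S.faceDim R + 1) (d : S.Tangent R → ℝ) :
    {y : S.Tangent F | ∀ z, ‖y - emb h z‖ = d z}.Finite := by
  set N := (emb h).linearIsometry
  set K := LinearMap.range N.toLinearMap
  have hK : Module.finrank ℝ Kᗮ = 1 := by
    have h1 := K.finrank_add_finrank_orthogonal
    have h2 : Module.finrank ℝ K = S.faceDim R := by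
      rw [LinearMap.finrank_range_of_inj N.injective, finrank_euclideanSpace_fin]
    rw [h2, finrank_euclideanSpace_fin] at h1
    omega
  obtain ⟨n, hn0, hn⟩ := finrank_eq_one_iff'.1 hK
  have hn1 : ‖(n : S.Tangent F)‖ ≠ 0 := by
    rw [norm_ne_zero_iff]
    exact fun h => hn0 (Subtype.ext h)
  rcases Set.eq_empty_or_nonempty {y : S.Tangent F | ∀ z, ‖y - emb h z‖ = d z} with he | ⟨y₀, hy₀⟩
  · rw [he]; exact Set.finite_empty
  set c := y₀ - perp N (y₀ - emb h 0)
  set ρ := ‖perp N (y₀ - emb h 0)‖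
  refine Set.Finite.subset (Set.toFinite {c + (ρ / ‖(n : S.Tangent F)‖) • (n : S.Tangent F),
    c + (-(ρ / ‖(n : S.Tangent F)‖)) • (n : S.Tangent F)}) fun y hy => ?_
  have heq : ∀ u, ‖y - emb h 0 - N u‖ = ‖y₀ - emb h 0 - N u‖ := fun u => by
    rw [norm_sub_center_sub, norm_sub_center_sub, hy, hy₀]
  obtain ⟨x, hx, hx₀⟩ := exists_eq_add_perp_and_eq_add_perp heq
  obtain ⟨s, hs⟩ := hn ⟨perp N (y - emb h 0), K.sub_starProjection_mem_orthogonal _⟩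
  have hs' : s • (n : S.Tangent F) = perp N (y - emb h 0) := congrArg Subtype.val hs
  have hy' : y = c + s • (n : S.Tangent F) := by
    rw [hs']
    calc y = y - emb h 0 + emb h 0 := by abel
      _ = N x + perp N (y - emb h 0) + emb h 0 := by rw [← hx]
      _ = (N x + perp N (y₀ - emb h 0)) + emb h 0 - perp N (y₀ - emb h 0) +
          perp N (y - emb h 0) := by abel
      _ = c + perp N (y - emb h 0) := by rw [← hx₀]; simp only [c]; abel
  have hρ : |s| = ρ / ‖(n : S.Tangent F)‖ := by
    rw [eq_div_iff hn1, ← Real.norm_eq_abs, ← norm_smul, hs']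
    exact norm_perp_eq heq
  rcases abs_choice s with h1 | h1
  · left; rw [hy', ← hρ, h1]
  · right
    rw [mem_singleton_iff, hy', ← hρ, h1, neg_neg]

theorem IsFoldingMap.ne_left {F G R : S.Face} {Φ : S.Tangent F ≃ᵃⁱ[ℝ] S.Tangent G}
    (h : S.IsFoldingMap F G R Φ) : ¬ S.IsFacet R := fun hR =>
  h.ne ((hR F h.subset_left).trans (hR G h.subset_right).symm)

theorem IsFoldingMap.norm_sub_eq {F G R : S.Face} {Φ : S.Tangent F ≃ᵃⁱ[ℝ] S.Tangent G}
    (h : S.IsFoldingMap F G R Φ) (p : S.Tangent F) (z : S.Tangent R) :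
    ‖Φ p - emb h.subset_right z‖ = ‖p - emb h.subset_left z‖ := by
  have hgl : Glues (Φ.toAffineIsometry.comp (emb h.subset_left)) := fun z hz => by
    have h1 := chart_emb h.subset_left hz
    obtain ⟨h2, h3⟩ := h.glue _ (emb_mem h.subset_left hz) (by rw [h1]; exact chart_mem_cell hz)
    exact ⟨h2, h3.trans h1⟩
  have h1 : Φ (emb h.subset_left z) = emb h.subset_right z := by
    rw [← hgl.unique (emb_glues h.subset_right)]; rfl
  rw [← h1, ← dist_eq_norm, ← dist_eq_norm, Φ.dist_map]

theorem finite_foldImages (v : S.Carrier) (k : ℕ) : ∀ F, (S.foldImages v k F).Finite := by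
  induction k with
  | zero =>
    intro F
    refine Set.Subsingleton.finite fun p hp q hq => ?_
    exact S.chart_injOn F hp.1 hq.1 (hp.2.trans hq.2.symm)
  | succ k ih =>
    intro G
    have hsub : S.foldImages v (k + 1) G ⊆ ⋃ (F : S.Face) (R : S.Face), ⋃ p ∈ S.foldImages v k F,
        {y | ∃ Φ, S.IsFoldingMap F G R Φ ∧ Φ p = y} := by
      rintro y ⟨F, R, Φ, hΦ, p, hp, rfl⟩
      simp only [mem_iUnion]
      exact ⟨F, R, p, hp, Φ, hΦ, rfl⟩
    refine Set.Finite.subset ?_ hsub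
    refine Set.finite_iUnion fun F => Set.finite_iUnion fun R => (ih F).biUnion fun p _ => ?_
    by_cases hex : ∃ Φ, S.IsFoldingMap F G R Φ
    · obtain ⟨Φ₀, hΦ₀⟩ := hex
      have hne : R ≠ G := fun h => hΦ₀.ne_left (h ▸ hΦ₀.facet_right)
      have hdim : S.faceDim G = S.faceDim R + 1 := by
        have h1 := face_dim_lt hΦ₀.subset_right hne
        have h2 := faceDim_le_dimension G
        have h3 : S.faceDim R + 1 = S.dimension := hΦ₀.ridge
        omega
      refine (finite_setOf_norm_sub_eq hΦ₀.subset_right hdim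
        fun z => ‖p - emb hΦ₀.subset_left z‖).subset ?_
      rintro _ ⟨Φ, hΦ, rfl⟩ z
      exact hΦ.norm_sub_eq p z
    · refine Set.finite_empty.subset ?_
      rintro y ⟨Φ, hΦ, -⟩
      exact hex ⟨Φ, hΦ⟩

/-! ### Sequential unfoldings as curves -/

theorem IsGeodesicOn.exists_segment {γ : ℝ → S.Carrier} {r s t : ℝ} (hγ : IsGeodesicOn γ r)
    (hs : 0 ≤ s) (hst : s < t) (ht : t ≤ r) {F : S.Face} (hF : ∀ u ∈ Ioo s t, γ u ∈ S.openCell F) :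
    ∃ e : S.Tangent F, ‖e‖ = 1 ∧ ∀ u ∈ Icc s t,
      γ u ∈ S.cell F ∧ S.pos F (γ u) = S.pos F (γ s) + (u - s) • e := by
  obtain ⟨f, e, hr⟩ := hγ.exists_right_ray ⟨hs, hst.trans_le ht⟩
  obtain ⟨f', e', hl⟩ := hγ.exists_left_ray ⟨hs.trans_lt hst, ht⟩
  obtain rfl : f = F := by
    obtain ⟨u, hu, hu'⟩ := (hr.eventually_cellOf.and (Ioo_mem_nhdsGT (sub_pos.2 hst))).exists
    rw [← hu]
    exact cellOf_eq (hF _ ⟨by linarith [hu'.1], by linarith [hu'.2]⟩)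
  obtain rfl : f' = f := by
    obtain ⟨u, hu, hu'⟩ := (hl.eventually_cellOf.and (Ioo_mem_nhdsGT (sub_pos.2 hst))).exists
    rw [← hu]
    exact cellOf_eq (hF _ ⟨by linarith [hu'.2], by linarith [hu'.1]⟩)
  have hst' : ∀ u ∈ Ioo s t, IsStraightAt γ u ∧ S.cell f' ⊆ S.cell (S.cellOf (γ u)) := fun u hu =>
    ⟨hγ.isStraightAt ⟨hs.trans_lt hu.1, hu.2.trans_le ht⟩, by rw [cellOf_eq (hF u hu)]⟩
  have hline : ∀ u ∈ Ioo s t, S.pos f' (γ u) = S.pos f' (γ s) + (u - s) • e := by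
    intro u hu
    have h1 := norm_pos_sub_eq_line (S.pos f' (γ s) + (u - s) • e) hst' ⟨le_rfl, hst⟩ hr
      Subset.rfl hu Subset.rfl (openCell_subset_cell _ (hF u hu))
    rw [emb_self, sub_self, norm_zero, norm_eq_zero, sub_eq_zero] at h1
    exact h1
  have hend : S.pos f' (γ t) = S.pos f' (γ s) + (t - s) • e := by
    have heq : ∀ᶠ u in 𝓝[>] (0 : ℝ), S.pos f' (γ t) + u • e' =
        S.pos f' (γ s) + (t - u - s) • e := by
      filter_upwards [hl.eventually, Ioo_mem_nhdsGT (sub_pos.2 hst)] with u hu hu'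
      rw [← hline (t - u) ⟨by linarith [hu'.2], by linarith [hu'.1]⟩, ← hu.2,
        pos_chart (interior_subset hu.1)]
    have hc1 : Tendsto (fun u : ℝ => S.pos f' (γ t) + u • e') (𝓝[>] 0) (𝓝 (S.pos f' (γ t))) :=
      (Continuous.tendsto' (by fun_prop) 0 _ (by simp)).mono_left nhdsWithin_le_nhds
    have hc2 : Tendsto (fun u : ℝ => S.pos f' (γ s) + (t - u - s) • e) (𝓝[>] 0)
        (𝓝 (S.pos f' (γ s) + (t - s) • e)) :=
      (Continuous.tendsto' (by fun_prop) 0 _ (by simp)).mono_left nhdsWithin_le_nhds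
    exact tendsto_nhds_unique (hc1.congr' heq) hc2
  refine ⟨e, hr.norm_eq, fun u hu => ?_⟩
  rcases hu.1.eq_or_lt with rfl | h1
  · exact ⟨hr.mem, by simp⟩
  rcases hu.2.eq_or_lt with rfl | h2
  · exact ⟨hl.mem, hend⟩
  · exact ⟨openCell_subset_cell _ (hF u ⟨h1, h2⟩), hline u ⟨h1, h2⟩⟩

/-- The curve `c` parametrizes the sequential unfolding `Γ` of `γ` over `[0, s]`, and does not turn
back. -/
structure IsUnfoldingCurve (γ : ℝ → S.Carrier) (F : S.Face) (s : ℝ) (Γ : Set (S.Tangent F))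
    (c : ℝ → S.Tangent F) : Prop where
  nonneg : 0 ≤ s
  image_eq : c '' Icc 0 s = Γ
  mem : c s ∈ S.poly F
  chart_eq : S.chart F (c s) = γ s
  no_turn : ∀ u ∈ Ioo 0 s, ∃ δ > 0, 0 ≤ u - δ ∧ u + δ ≤ s ∧
    ‖c (u - δ) - c u‖ = ‖c (u + δ) - c u‖ ∧ c (u - δ) ≠ c (u + δ)

theorem IsUnfoldingCurve.extend {γ : ℝ → S.Carrier} {r s t : ℝ} (hγ : IsGeodesicOn γ r)
    {F : S.Face} {Γ : Set (S.Tangent F)} {c : ℝ → S.Tangent F} (hc : IsUnfoldingCurve γ F s Γ c)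
    (hend : s = 0 ∨ ∀ᶠ δ in 𝓝[>] (0 : ℝ), ‖c (s - δ) - c s‖ = δ ∧ c (s - δ) ∉ interior (S.poly F))
    (hst : s < t) (ht : t ≤ r) (hF : ∀ u ∈ Ioo s t, γ u ∈ S.openCell F) :
    ∃ c', c' 0 = c 0 ∧ IsUnfoldingCurve γ F t (Γ ∪ S.piece γ F s t) c' ∧
      ∀ᶠ δ in 𝓝[>] (0 : ℝ), ‖c' (t - δ) - c' t‖ = δ ∧ c' (t - δ) ∈ S.poly F := by
  classical
  obtain ⟨e, he, hseg⟩ := hγ.exists_segment hc.nonneg hst ht hF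
  have hs : S.pos F (γ s) = c s := by rw [← hc.chart_eq, pos_chart hc.mem]
  rw [hs] at hseg
  let l : ℝ → S.Tangent F := fun u => c s + (u - s) • e
  have hl : ∀ u ∈ Icc s t, l u ∈ S.poly F ∧ S.chart F (l u) = γ u := fun u hu => by
    obtain ⟨h1, h2⟩ := hseg u hu
    simp only [l]
    rw [← h2]
    exact ⟨pos_mem h1, chart_pos h1⟩
  have hlint : ∀ u ∈ Ioo s t, l u ∈ interior (S.poly F) := fun u hu => by
    have h1 := (hseg u ⟨hu.1.le, hu.2.le⟩).2
    simp only [l]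
    rw [← h1]
    exact pos_mem_interior (hF u hu)
  have hlsub : ∀ u w, ‖l u - l w‖ = |u - w| := fun u w => by
    simp only [l]
    rw [add_sub_add_left_eq_sub, ← sub_smul, norm_smul, he, mul_one, sub_sub_sub_cancel_right,
      Real.norm_eq_abs]
  have hls : l s = c s := by simp [l]
  let c' : ℝ → S.Tangent F := fun u => if u ≤ s then c u else l u
  have hc'1 : ∀ u ≤ s, c' u = c u := fun u hu => if_pos hu
  have hc'2 : ∀ u, s ≤ u → c' u = l u := fun u hu => by
    rcases hu.eq_or_lt with rfl | h
    · rw [hc'1 _ le_rfl, hls]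
    · exact if_neg (not_le.2 h)
  refine ⟨c', hc'1 0 hc.nonneg, ⟨hc.nonneg.trans hst.le, ?_, ?_, ?_, ?_⟩, ?_⟩
  · rw [← Icc_union_Icc_eq_Icc hc.nonneg hst.le, image_union,
      image_congr (fun u hu => hc'1 u hu.2), hc.image_eq, image_congr (fun u hu => hc'2 u hu.1)]
    congr 1
    ext p
    constructor
    · rintro ⟨u, hu, rfl⟩
      exact ⟨(hl u hu).1, u, hu, (hl u hu).2.symm⟩
    · rintro ⟨hp, u, hu, hup⟩
      exact ⟨u, hu, S.chart_injOn F (hl u hu).1 hp ((hl u hu).2.trans hup)⟩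
  · rw [hc'2 t hst.le]; exact (hl t ⟨hst.le, le_rfl⟩).1
  · rw [hc'2 t hst.le]; exact (hl t ⟨hst.le, le_rfl⟩).2
  · intro u hu
    rcases lt_trichotomy u s with hus | rfl | hsu
    · obtain ⟨δ, hδ, h1, h2, h3⟩ := hc.no_turn u ⟨hu.1, hus⟩
      refine ⟨δ, hδ, h1, h2.trans hst.le, ?_⟩
      rw [hc'1 _ (by linarith), hc'1 _ hus.le, hc'1 _ h2]
      exact h3
    · have hend' := hend.resolve_left hu.1.ne'
      obtain ⟨δ, ⟨h1, h2⟩, hδ⟩ := (hend'.and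
        (Ioo_mem_nhdsGT (lt_min hu.1 (sub_pos.2 hst)))).exists
      have h3 := hδ.2.trans_le (min_le_left _ _)
      have h4 := hδ.2.trans_le (min_le_right _ _)
      refine ⟨δ, hδ.1, by linarith, by linarith, ?_⟩
      rw [hc'1 _ (by linarith [hδ.1]), hc'1 _ le_rfl, hc'2 _ (by linarith [hδ.1])]
      constructor
      · rw [h1, ← hls, hlsub, add_sub_cancel_left, abs_of_pos hδ.1]
      · intro h
        exact h2 (h ▸ hlint _ ⟨by linarith [hδ.1], by linarith⟩)
    · have hδ : 0 < min (u - s) (t - u) := lt_min (sub_pos.2 hsu) (sub_pos.2 hu.2)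
      set δ := min (u - s) (t - u)
      have h1 : δ ≤ u - s := min_le_left _ _
      have h2 : δ ≤ t - u := min_le_right _ _
      refine ⟨δ, hδ, by linarith [hc.nonneg], by linarith, ?_⟩
      rw [hc'2 _ (by linarith), hc'2 _ hsu.le, hc'2 _ (by linarith), hlsub, hlsub]
      constructor
      · rw [sub_sub_cancel_left, add_sub_cancel_left, abs_neg]
      · intro h
        have h3 := hlsub (u - δ) (u + δ)
        rw [h, sub_self, norm_zero, eq_comm, abs_eq_zero] at h3
        linarith
  · filter_upwards [Ioo_mem_nhdsGT (sub_pos.2 hst)] with δ hδ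
    have h1 : t - δ ∈ Icc s t := ⟨by linarith [hδ.2], by linarith [hδ.1]⟩
    rw [hc'2 _ h1.1, hc'2 t hst.le, hlsub, sub_sub_cancel_left, abs_neg, abs_of_pos hδ.1]
    exact ⟨rfl, (hl _ h1).1⟩

theorem UnfoldsTo.exists_curve {γ : ℝ → S.Carrier} {r s : ℝ} (hγ : IsGeodesicOn γ r) {F : S.Face}
    {Γ : Set (S.Tangent F)} (h : S.UnfoldsTo γ F s Γ) (hs : s ≤ r) :
    ∃ (A : Finset ℝ) (c : ℝ → S.Tangent F), Separated γ r A ∧ (∀ a ∈ A, a < s) ∧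
      (A.Nonempty → γ s ∉ S.facetInteriors) ∧ c 0 ∈ S.foldImages (γ 0) A.card F ∧
      IsUnfoldingCurve γ F s Γ c ∧
      (s = 0 ∨ ∀ᶠ δ in 𝓝[>] (0 : ℝ), ‖c (s - δ) - c s‖ = δ ∧
        c (s - δ) ∉ interior (S.poly F)) := by
  classical
  induction h with
  | start F hF p hp h =>
    refine ⟨∅, fun _ => p, ⟨by simp, by simp⟩, by simp, by simp, ⟨interior_subset hp, h⟩,
      ⟨le_rfl, by simp, interior_subset hp, h, by simp⟩, Or.inl rfl⟩
  | cross F G R s t Γ h hst hF ht Φ hΦ ih =>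
    obtain ⟨A, c, hA, hAs, hAne, hc0, hc, hend⟩ := ih (hst.le.trans hs)
    obtain ⟨c', hc'0, hc', hend'⟩ := hc.extend hγ hend hst hs hF
    have hmid : (s + t) / 2 ∈ Ioo s t := ⟨by linarith, by linarith⟩
    have hmA : (s + t) / 2 ∉ A := fun hm => absurd (hAs _ hm) (not_lt.2 hmid.1.le)
    have hmF : γ ((s + t) / 2) ∈ S.facetInteriors := by
      rw [mem_facetInteriors, cellOf_eq (hF _ hmid)]
      exact hΦ.facet_left
    have htF : γ t ∉ S.facetInteriors := fun hf => by
      rw [mem_facetInteriors] at hf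
      exact hΦ.ne_left ((hf R (cell_subset_of_mem ht)).symm ▸ hf)
    refine ⟨insert ((s + t) / 2) A, fun u => Φ (c' u), ⟨fun a ha => ?_, fun a ha b hb hab => ?_⟩,
      fun a ha => ?_, fun _ => htF, ?_, ⟨hc'.nonneg, ?_, ?_, ?_, fun u hu => ?_⟩, Or.inr ?_⟩
    · rcases Finset.mem_insert.1 ha with rfl | ha
      · exact ⟨⟨by linarith [hmid.1, hc.nonneg], by linarith [hmid.2]⟩, hmF⟩
      · exact hA.1 a ha
    · rcases Finset.mem_insert.1 ha with rfl | ha₁ <;> rcases Finset.mem_insert.1 hb with rfl | hb₁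
      · exact absurd hab (lt_irrefl _)
      · exact absurd (hab.trans (hAs b hb₁)) (not_lt.2 hmid.1.le)
      · exact ⟨s, ⟨hAs a ha₁, hmid.1⟩, hAne ⟨a, ha₁⟩⟩
      · exact hA.2 a ha₁ b hb₁ hab
    · rcases Finset.mem_insert.1 ha with rfl | ha
      · exact hmid.2
      · exact (hAs a ha).trans hst
    · rw [Finset.card_insert_of_notMem hmA]
      exact ⟨F, R, Φ, hΦ, c 0, hc0, congrArg Φ hc'0.symm⟩
    · rw [← hc'.image_eq, image_image]
    · exact (hΦ.glue _ hc'.mem (by rw [hc'.chart_eq]; exact ht)).1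
    · rw [(hΦ.glue _ hc'.mem (by rw [hc'.chart_eq]; exact ht)).2, hc'.chart_eq]
    · obtain ⟨δ, hδ, h1, h2, h3, h4⟩ := hc'.no_turn u hu
      refine ⟨δ, hδ, h1, h2, ?_, fun heq => h4 (Φ.injective heq)⟩
      simp only [← dist_eq_norm, Φ.dist_map] at h3 ⊢
      exact h3
    · filter_upwards [hend'] with δ hδ
      refine ⟨?_, fun hi => disjoint_left.1 hΦ.disjoint (mem_image_of_mem Φ hδ.2) hi⟩
      rw [← dist_eq_norm, Φ.dist_map, dist_eq_norm]
      exact hδ.1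

theorem eq_of_mem_segment_of_norm_sub_eq {E : Type*} [NormedAddCommGroup E] [NormedSpace ℝ E]
    {ν q x y : E} (hx : x ∈ segment ℝ ν q) (hy : y ∈ segment ℝ ν q) (h : ‖x - ν‖ = ‖y - ν‖) :
    x = y := by
  rw [segment_eq_image'] at hx hy
  obtain ⟨a, ha, rfl⟩ := hx
  obtain ⟨b, hb, rfl⟩ := hy
  simp only [add_sub_cancel_left, norm_smul, Real.norm_eq_abs, abs_of_nonneg ha.1,
    abs_of_nonneg hb.1] at h
  rcases mul_eq_mul_right_iff.1 h with h | h
  · rw [h]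
  · simp [norm_eq_zero.1 h]

/-- If an unfolding curve traces a segment, then it starts at an end point of the segment. -/
theorem IsUnfoldingCurve.eq_start {γ : ℝ → S.Carrier} {F : S.Face} {s : ℝ} {Γ : Set (S.Tangent F)}
    {c : ℝ → S.Tangent F} (hc : IsUnfoldingCurve γ F s Γ c) {ν q : S.Tangent F}
    (hΓ : Γ = segment ℝ ν q) (hq : c s = q) : ν = c 0 := by
  have hmem : ∀ u ∈ Icc 0 s, c u ∈ segment ℝ ν q := fun u hu => by
    rw [← hΓ, ← hc.image_eq]; exact mem_image_of_mem c hu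
  obtain ⟨u, hu, huν⟩ : ν ∈ c '' Icc 0 s := by
    rw [hc.image_eq, hΓ]; exact left_mem_segment ℝ ν q
  rcases hu.1.eq_or_lt with rfl | h0
  · exact huν.symm
  rcases hu.2.eq_or_lt with rfl | hs
  · have h1 := hmem 0 ⟨le_rfl, hc.nonneg⟩
    rw [← hq, huν, segment_same, mem_singleton_iff] at h1
    exact h1.symm
  · obtain ⟨δ, hδ, h1, h2, h3, h4⟩ := hc.no_turn u ⟨h0, hs⟩
    rw [huν] at h3
    exact absurd (eq_of_mem_segment_of_norm_sub_eq (hmem _ ⟨h1, by linarith⟩)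
      (hmem _ ⟨by linarith, h2⟩) h3) h4

theorem finite_sourceImages {F : S.Face} (hF : Bornology.IsBounded (S.poly F)) (v : S.Carrier) :
    (S.sourceImages v F).Finite := by
  rcases (S.sourceImages v F).eq_empty_or_nonempty with he | hne
  · rw [he]; exact Set.finite_empty
  obtain ⟨-, γ₀, r₀, q₀, -, -, hγ₀, hv₀, hq₀, hq₀r, -⟩ := hne
  obtain ⟨C, hC⟩ := Metric.isBounded_iff.1 hF
  have hC0 : 0 ≤ C := dist_nonneg.trans (hC hq₀ hq₀)
  obtain ⟨N, -, hN⟩ := S.exists_separated_bound (r₀ + C)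
  refine (Set.finite_iUnion fun k : Fin (N + 1) => finite_foldImages v k F).subset ?_
  rintro ν ⟨γ, r, q, s, Γ, hγ, rfl, hq, hqr, -, hunf, hsr, hin, hseg⟩
  have hgeo := hγ.isGeodesicOn
  have hlen : ∀ {γ : ℝ → S.Carrier} {r : ℝ}, S.IsShortestPath γ r →
      edist (γ 0) (γ r) = ENNReal.ofReal r := fun {γ r} h => by
    rw [h.isGeodesicOn 0 ⟨le_rfl, h.nonneg⟩ r ⟨h.nonneg, le_rfl⟩, zero_sub, abs_neg,
      abs_of_nonneg h.nonneg]
  have hr : r ≤ r₀ + C := by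
    have h1 := edist_triangle (γ 0) (γ₀ r₀) (γ r)
    rw [hlen hγ, ← hv₀, hlen hγ₀, ← hq₀r, ← hqr] at h1
    have h2 : edist (S.chart F q₀) (S.chart F q) ≤ ENNReal.ofReal C :=
      (edist_chart_le hq₀ hq).trans (ENNReal.ofReal_le_ofReal (dist_eq_norm q₀ q ▸ hC hq₀ hq))
    have h3 := h1.trans (add_le_add_right h2 _)
    rwa [← ENNReal.ofReal_add hγ₀.nonneg hC0,
      ENNReal.ofReal_le_ofReal_iff (add_nonneg hγ₀.nonneg hC0)] at h3
  obtain ⟨A, c, hA, -, -, hc0, hc, hend⟩ := hunf.exists_curve hgeo hsr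
  have hk : A.card < N + 1 := Nat.lt_succ_of_le (hN γ r hr hgeo A hA)
  refine mem_iUnion.2 ⟨⟨A.card, hk⟩, ?_⟩
  suffices hν : ν = c 0 by rw [hν]; exact hc0
  rcases hsr.eq_or_lt with rfl | hlt
  · have hqc : c s = q := S.chart_injOn F hc.mem hq (hc.chart_eq.trans hqr.symm)
    refine hc.eq_start (hseg ▸ (union_eq_self_of_subset_right ?_).symm) hqc
    rintro p ⟨hp, u, hu, hup⟩
    rw [Icc_self, mem_singleton_iff] at hu
    subst hu
    rw [← hc.image_eq]
    exact ⟨u, ⟨hc.nonneg, le_rfl⟩, S.chart_injOn F hc.mem hp (hc.chart_eq.trans hup)⟩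
  · obtain ⟨c', hc'0, hc', -⟩ := hc.extend hgeo hend hlt le_rfl hin
    rw [← hc'0]
    exact hc'.eq_start hseg (S.chart_injOn F hc'.mem hq (hc'.chart_eq.trans hqr.symm))

end PolyhedralComplex

theorem mainTheorem10 :
    (∀ S : PolyhedralComplex, S.IsConvex → ∀ r : ℝ, 0 ≤ r →
      ∃ N : ℕ, 0 < N ∧ ∀ γ : ℝ → S.Carrier, S.IsShortestPath γ r →
        (∃ L, S.IsFacetSequence γ r L) ∧ ∀ L, S.IsFacetSequence γ r L → L.length ≤ N) ∧
    (∀ S : PolyhedralComplex, S.IsConvexPseudomanifold → ∀ v ∈ S.facetInteriors,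
      ∀ F, S.IsFacet F → (S.sourceImages v F).Finite) := by
  refine ⟨fun S _ r _ => ?_, fun S hS v _ F hF => S.finite_sourceImages (hS.bounded F hF) v⟩
  obtain ⟨N, hN0, hN⟩ := S.exists_separated_bound r
  refine ⟨N, hN0, fun γ hγ => ?_⟩
  have hA := hN γ r le_rfl hγ.isGeodesicOn
  exact ⟨PolyhedralComplex.exists_isFacetSequence hA, fun L hL => hL.length_le hA⟩
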